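/- Let $\rho:\mathbb N\to\mathbb R$ with $\rho(0)=1$, and let $(a_k)_{k\ge1}$, $(b_k)_{k\ge1}$ be two independent sequences of jointly Gaussian, centered random variables with $\mathbb E[a_ka_\ell]=\mathbb E[b_kb_\ell]=\rho(|k-\ell|)$ for all $k,\ell\ge1$. For $n\ge1$ let $$f_n(t)=\sum_{k=1}^n a_k\cos(kt)+b_k\sin(kt),$$ and let $N_n$ be the number of distinct zeros of $f_n$ in $[0,2\pi]$. Assume that (S) for every $x\in\,]0,2\pi[$ the series $\psi_\rho(x)=\sum_{k\in\mathbb Z}\rho(|k|)e^{ikx}$ converges (as the limit of the partial sums over $|k|\le N$), and the function $\psi_\rho$ is integrable on $]0,2\pi[$, continuous on $]0,2\pi[$, and satisfies $\inf_{]0,2\pi[}\psi_\rho>0$. Then, for every $n\ge1$, $N_n$ is (almost everywhere equal to) a random variable with finite expectation, and $$\mathbb E[N_n]=\frac{2n}{\sqrt3}\,(1+o(1))\qquad(n\to\infty).$$ Moreover, hypothesis (S) allows long-range dependence: for every $1/2<H<1$, the correlation function of fractional Gaussian noise, $\rho_H(k)=\frac12\left(|1+k|^{2H}+|1-k|^{2H}-2|k|^{2H}\right)$,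 satisfies (S), although $\sum_{k}\rho_H(k)$ does not converge absolutely. -/

import Mathlib

open MeasureTheory ProbabilityTheory Filter Topology Asymptotics
open scoped ENNReal

/-- The sequence `a` is a sequence of jointly Gaussian, centered, standard random variables with
correlation function `ρ`, that is `E[a_k a_l] = ρ(|k - l|)` and `ρ(0) = 1`. The index `k : ℕ`
stands for the `(k + 1)`-st term of a sequence that starts at `1`; this changes no difference
`k - l` of indices. -/
structure IsStandardStationaryGaussian {Ω : Type*} [MeasurableSpace Ω] (P : Measure Ω)
    (ρ : ℕ → ℝ) (a : ℕ → Ω → ℝ) : Prop where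
  measurable : ∀ k, Measurable (a k)
  gaussian : IsGaussianProcess a P
  mean_zero : ∀ k, ∫ ω, a k ω ∂P = 0
  cov : ∀ k l : ℕ, ∫ ω, a k ω * a l ω ∂P = ρ (((k : ℤ) - (l : ℤ)).natAbs)
  standard : ρ 0 = 1

/-- On `]0, 2π[`, the real function `ψ` is the sum of the (possibly only conditionally convergent)
series `∑_{k ∈ ℤ} ρ(|k|) e^{ikx}`, taken as the limit of its symmetric partial sums. The values of
`ψ` outside `]0, 2π[` are irrelevant. -/
def IsSpectralFunction (ρ : ℕ → ℝ) (ψ : ℝ → ℝ) : Prop :=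
  ∀ x ∈ Set.Ioo 0 (2 * Real.pi),
    Tendsto (fun N : ℕ => ∑ k ∈ Finset.Icc (-(N : ℤ)) (N : ℤ),
        (ρ k.natAbs : ℂ) * Complex.exp (Complex.I * (k : ℂ) * (x : ℂ)))
      atTop (𝓝 ((ψ x : ℝ) : ℂ))

/-- The spectral function of `ρ` exists on `]0, 2π[`, is integrable, is continuous, and has a
positive lower bound. -/
def SpectralHypotheses (ρ : ℕ → ℝ) : Prop :=
  ∃ ψ : ℝ → ℝ, IsSpectralFunction ρ ψ ∧
    IntegrableOn ψ (Set.Ioo 0 (2 * Real.pi)) ∧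
    ContinuousOn ψ (Set.Ioo 0 (2 * Real.pi)) ∧
    ∃ γ : ℝ, 0 < γ ∧ ∀ x ∈ Set.Ioo 0 (2 * Real.pi), γ ≤ ψ x

/-- `f_n(t) = ∑_{k=1}^n (a_k cos(kt) + b_k sin(kt))`, with `a k`, `b k` the `(k + 1)`-st terms. -/
noncomputable def trigPoly {Ω : Type*} (a b : ℕ → Ω → ℝ) (n : ℕ) (ω : Ω) (t : ℝ) : ℝ :=
  ∑ k ∈ Finset.range n,
    (a k ω * Real.cos (((k : ℝ) + 1) * t) + b k ω * Real.sin (((k : ℝ) + 1) * t))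

/-- The number of distinct zeros of `f_n` in `[0, 2π]`, as an extended nonnegative number. -/
noncomputable def numZeros {Ω : Type*} (a b : ℕ → Ω → ℝ) (n : ℕ) (ω : Ω) : ℝ≥0∞ :=
  ({t : ℝ | t ∈ Set.Icc 0 (2 * Real.pi) ∧ trigPoly a b n ω t = 0}.encard : ℝ≥0∞)

/-- The correlation function of fractional Gaussian noise with Hurst index `H`. -/
noncomputable def fgnCorrelation (H : ℝ) (k : ℕ) : ℝ :=
  (1 / 2) * (|1 + (k : ℝ)| ^ (2 * H) + |1 - (k : ℝ)| ^ (2 * H) - 2 * |(k : ℝ)| ^ (2 * H))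

/-! Kac-Rice formula. Let u(t) be the covariance of f_n(t) with the first coefficient, called a_0
below. Gaussian regression gives f_n = a_0 u + g with g independent of a_0. The zeros of u are
countably many, and almost surely f_n vanishes at none of them. Elsewhere f_n(t) = 0 means that -g/u
crosses the random level a_0. With g frozen, the area formula integrates the number of crossings
against the Gaussian density of the level. This gives E[N_n] as the integral over ]0, 2π[ of √(V D -
C²) / (π V), with no limiting argument in the level, where V, C, D are the covariances of (f_n,
f_n') (`kacRice`).

Asymptotics. V is a sum of the partial sums of the spectral series and D a weighted sum of the V's,
so two Cesàro arguments give V/n → ψ and D/n³ → ψ/3 pointwise. The covariance C is not handled by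
such averaging. Instead, E[(x f_n - y f_n')²] is 1/(2π) times the integral of a nonnegative kernel
against the spectral measure, and Fatou's lemma applied to the Fejér means V_N/N shows that this
measure dominates ψ(θ) dθ (`integral_le_of_le_mul_trigKernel`). For x = n, y = ±1 the kernel
concentrates at t, so the quadratic form is at least about (4/3) ψ(t) n³. This is already the size
of n² V + D, hence C = o(n²) (`tendsto_trigCov_div`). The density divided by n thus tends to
1/(π√3).

Passage to the integral. The same domination gives V ≥ γ n. Since the integral of D is explicit and
of order n³, the normalized densities are bounded in L², and the integrals converge to 2π/(π√3) =
2/√3.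

Fractional noise. ρ_H is a convex sequence tending to 0. Double summation by parts writes its
spectral series as a combination of Fejér-type kernels with nonnegative coefficients, the second
differences; the first of them is a positive lower bound (`spectralHypotheses_of_convex`). The sums
of ρ_H telescope and diverge. -/

/-! ### Area formula on the line. -/

section AreaFormula

/-- A function with nonvanishing continuous derivative on an open set is injective on each piece of
a suitable countable measurable partition of this set. -/
theorem exists_partition_injOn_of_deriv_ne_zero {g g' : ℝ → ℝ} {s : Set ℝ} (hs : IsOpen s)
    (hg : ∀ t ∈ s, HasDerivAt g (g' t) t) (hg' : ContinuousOn g' s) (h0 : ∀ t ∈ s, g' t ≠ 0) :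
    ∃ T : ℕ → Set ℝ, (∀ i, MeasurableSet (T i)) ∧ Pairwise (Function.onFun Disjoint T) ∧
      (∀ i, Set.InjOn g (T i)) ∧ (⋃ i, T i) = s := by
  have key : ∀ t : ℝ, ∃ U : Set ℝ, IsOpen U ∧ (t ∈ s → t ∈ U) ∧ Set.InjOn g (s ∩ U) := by
    intro t
    by_cases ht : t ∈ s
    · have hst : HasStrictDerivAt g (g' t) t :=
        hasStrictDerivAt_of_hasDerivAt_of_continuousAt
          (Filter.eventually_of_mem (hs.mem_nhds ht) hg) (hg'.continuousAt (hs.mem_nhds ht))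
      have hf := hst.hasStrictFDerivAt_equiv (h0 t ht)
      exact ⟨hf.toOpenPartialHomeomorph g |>.source, (hf.toOpenPartialHomeomorph g).open_source,
        fun _ => hf.mem_toOpenPartialHomeomorph_source,
        ((hf.toOpenPartialHomeomorph g).injOn).mono Set.inter_subset_right⟩
    · exact ⟨∅, isOpen_empty, fun h => absurd h ht, by simp⟩
  choose U hUo hUm hUi using key
  obtain ⟨c, hcs, hc, hcov⟩ := TopologicalSpace.countable_cover_nhdsWithin (s := s) (f := U)
    (fun x hx => mem_nhdsWithin_of_mem_nhds ((hUo x).mem_nhds (hUm x hx)))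
  rcases c.eq_empty_or_nonempty with rfl | hne
  · refine ⟨fun _ => ∅, by simp, fun i j _ => by simp [Function.onFun], by simp, ?_⟩
    have : s = ∅ := by simpa using hcov
    simp [this]
  obtain ⟨e, rfl⟩ := hc.exists_eq_range hne
  refine ⟨fun i => s ∩ disjointed (fun i => U (e i)) i, fun i => hs.measurableSet.inter
    (MeasurableSet.disjointed (fun i => (hUo (e i)).measurableSet) i), ?_, ?_, ?_⟩
  · intro i j hij
    exact ((disjoint_disjointed _) hij).mono Set.inter_subset_right Set.inter_subset_right
  · intro i
    exact (hUi (e i)).mono (Set.inter_subset_inter_right _ (disjointed_subset _ _))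
  · rw [← Set.inter_iUnion, iUnion_disjointed]
    apply Set.inter_eq_left.2
    simpa using hcov

/-- The area formula in dimension one. -/
theorem lintegral_mul_encard_eq_lintegral_abs_deriv {g g' : ℝ → ℝ} {s : Set ℝ} (hs : IsOpen s)
    (hg : ∀ t ∈ s, HasDerivAt g (g' t) t) (hg' : ContinuousOn g' s) {F : ℝ → ℝ≥0∞}
    (hF : Measurable F) :
    ∫⁻ y, F y * ({t | t ∈ s ∧ g t = y}.encard : ℝ≥0∞) =
      ∫⁻ t in s, F (g t) * ENNReal.ofReal |g' t| := by
  classical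
  set s' : Set ℝ := s ∩ g' ⁻¹' {0}ᶜ with hs'
  have hs'o : IsOpen s' := hg'.isOpen_inter_preimage hs isOpen_compl_singleton
  obtain ⟨T, hTm, hTd, hTi, hTs⟩ := exists_partition_injOn_of_deriv_ne_zero hs'o
    (fun t ht => hg t ht.1) (hg'.mono Set.inter_subset_left) (fun t ht => ht.2)
  have hTsub : ∀ i, T i ⊆ s := fun i t ht =>
    ((hTs ▸ Set.mem_iUnion_of_mem i ht : t ∈ s')).1
  have hgc : ContinuousOn g s := fun t ht => (hg t ht).continuousAt.continuousWithinAt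
  have him : ∀ i, MeasurableSet (g '' T i) := fun i =>
    (hTm i).image_of_continuousOn_injOn (hgc.mono (hTsub i)) (hTi i)
  set B : Set ℝ := s ∩ g' ⁻¹' {0} with hB
  -- Sard: critical values are null. On the left they can be discarded; on the right critical points
  -- contribute 0 because of the factor `|g' t|`.
  have hnull : volume (g '' B) = 0 := by
    apply addHaar_image_eq_zero_of_det_fderivWithin_eq_zero volume (s := B)
      (f' := fun t => ContinuousLinearMap.toSpanSingleton ℝ (g' t))
    · intro t ht
      exact (hg t ht.1).hasFDerivAt.hasFDerivWithinAt
    · intro t ht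
      simpa using ht.2
  have hcount : ∀ y ∉ g '' B, ({t | t ∈ s ∧ g t = y}.encard : ℝ≥0∞) =
      ∑' i, (g '' T i).indicator (fun _ => (1 : ℝ≥0∞)) y := by
    intro y hy
    have hsub : ∀ i, {t | t ∈ T i ∧ g t = y}.Subsingleton := fun i a ha b hb =>
      hTi i ha.1 hb.1 (ha.2.trans hb.2.symm)
    have hU : {t | t ∈ s ∧ g t = y} = ⋃ i, {t | t ∈ T i ∧ g t = y} := by
      ext t
      simp only [Set.mem_ofPred_eq, Set.mem_iUnion]
      constructor
      · rintro ⟨h1, h2⟩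
        have : t ∈ s' := ⟨h1, fun h => hy ⟨t, ⟨h1, h⟩, h2⟩⟩
        rw [← hTs] at this
        obtain ⟨i, hi⟩ := Set.mem_iUnion.1 this
        exact ⟨i, hi, h2⟩
      · rintro ⟨i, h1, h2⟩
        exact ⟨hTsub i h1, h2⟩
    have hm : ∀ i, MeasurableSet {t | t ∈ T i ∧ g t = y} := fun i => (hsub i).measurableSet
    rw [hU, ← Measure.count_apply (MeasurableSet.iUnion hm), measure_iUnion _ hm]
    · congr 1
      ext i
      rw [Measure.count_apply (hm i)]
      by_cases hyi : y ∈ g '' T i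
      · obtain ⟨t, ht, rfl⟩ := hyi
        have : {t' | t' ∈ T i ∧ g t' = g t} = {t} :=
          (hsub i).eq_singleton_of_mem ⟨ht, rfl⟩
        rw [this]
        simp [Set.indicator_of_mem (Set.mem_image_of_mem g ht)]
      · have : {t | t ∈ T i ∧ g t = y} = ∅ := by
          ext t
          simp only [Set.mem_ofPred_eq, Set.mem_empty_iff_false, iff_false]
          exact fun h => hyi ⟨t, h.1, h.2⟩
        rw [this]
        simp [hyi]
    · intro i j hij
      exact (hTd hij).mono (fun t h => h.1) (fun t h => h.1)
  calc ∫⁻ y, F y * ({t | t ∈ s ∧ g t = y}.encard : ℝ≥0∞)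
      = ∫⁻ y, ∑' i, (g '' T i).indicator F y := by
        apply lintegral_congr_ae
        filter_upwards [compl_mem_ae_iff.2 hnull] with y hy
        rw [hcount y hy, ← ENNReal.tsum_mul_left]
        congr 1
        ext i
        by_cases h : y ∈ g '' T i <;> simp [h]
    _ = ∑' i, ∫⁻ y in g '' T i, F y := by
        rw [lintegral_tsum (fun i => (hF.indicator (him i)).aemeasurable)]
        congr 1
        ext i
        rw [lintegral_indicator (him i)]
    _ = ∑' i, ∫⁻ t in T i, F (g t) * ENNReal.ofReal |g' t| := by
        congr 1
        ext i
        rw [lintegral_image_eq_lintegral_abs_deriv_mul (hTm i)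
          (fun t ht => (hg t (hTsub i ht)).hasDerivWithinAt) (hTi i)]
        simp_rw [mul_comm]
    _ = ∫⁻ t in s', F (g t) * ENNReal.ofReal |g' t| := by
        rw [← hTs, lintegral_iUnion hTm hTd]
    _ = ∫⁻ t in s, F (g t) * ENNReal.ofReal |g' t| := by
        have hsplit : s' = s \ B := by
          ext t
          simp only [hs', hB, Set.mem_inter_iff, Set.mem_sdiff, Set.mem_preimage,
            Set.mem_compl_iff, not_and]
          tauto
        have hBm : MeasurableSet B := by
          have : B = s \ s' := by
            ext t
            simp only [hs', hB, Set.mem_inter_iff, Set.mem_sdiff, Set.mem_preimage,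
              Set.mem_compl_iff, not_and, not_not]
            tauto
          rw [this]
          exact hs.measurableSet.diff hs'o.measurableSet
        rw [← lintegral_inter_add_sdiff (μ := volume) _ s hBm, ← hsplit,
          setLIntegral_congr_fun (hs.measurableSet.inter hBm) (g := fun _ => 0)]
        · simp
        · intro t ht
          have : g' t = 0 := ht.2.2
          simp [this]

end AreaFormula

/-! ### Measurability of the number of zeros. -/

section CountMeasurable

/-- The number of points of a set of reals is the supremum of the numbers of cells of size `1 / m`
that it meets. -/
theorem encard_eq_iSup_encard_image_floor (Z : Set ℝ) :
    Z.encard = ⨆ m : ℕ, ((fun t : ℝ => ⌊(m : ℝ) * t⌋) '' Z).encard := by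
  apply le_antisymm
  · have hfin : ∀ F : Finset ℝ, (F : Set ℝ) ⊆ Z →
        ((F.card : ℕ) : ℕ∞) ≤ ⨆ m : ℕ, ((fun t : ℝ => ⌊(m : ℝ) * t⌋) '' Z).encard := by
      intro F hF
      -- Cells shorter than the smallest gap between two points of `F` separate them.
      have : ∃ m : ℕ, Set.InjOn (fun t : ℝ => ⌊(m : ℝ) * t⌋) (F : Set ℝ) := by
        have hev : ∀ p ∈ F ×ˢ F, ∀ᶠ m : ℕ in atTop,
            (⌊(m : ℝ) * p.1⌋ = ⌊(m : ℝ) * p.2⌋ → p.1 = p.2) := by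
          intro p _
          by_cases hp : p.1 = p.2
          · exact Eventually.of_forall fun _ _ => hp
          have hpos : 0 < |p.1 - p.2| := abs_pos.2 (sub_ne_zero.2 hp)
          obtain ⟨M, hM⟩ := exists_nat_gt (1 / |p.1 - p.2|)
          filter_upwards [eventually_ge_atTop M] with m hm heq
          exfalso
          have h1 := Int.abs_sub_lt_one_of_floor_eq_floor heq
          rw [← mul_sub, abs_mul, Nat.abs_cast] at h1
          have h2 : (1 : ℝ) < m * |p.1 - p.2| := by
            rw [div_lt_iff₀ hpos] at hM
            have : (M : ℝ) ≤ m := by exact_mod_cast hm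
            nlinarith
          linarith
        obtain ⟨m, hm⟩ := ((Filter.eventually_all_finset (F ×ˢ F)).2 hev).exists
        exact ⟨m, fun a ha b hb hab => hm (a, b) (Finset.mk_mem_product ha hb) hab⟩
      obtain ⟨m, hm⟩ := this
      refine le_trans ?_ (le_iSup _ m)
      rw [← Set.encard_coe_eq_coe_finsetCard, ← hm.encard_image]
      exact Set.encard_le_encard (Set.image_mono hF)
    rcases Z.finite_or_infinite with hZ | hZ
    · have := hfin hZ.toFinset (by simp)
      rwa [← Set.encard_coe_eq_coe_finsetCard, hZ.coe_toFinset] at this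
    · rw [hZ.encard_eq, top_le_iff, ENat.eq_top_iff_forall_ge]
      intro n
      obtain ⟨F, hF, hFc⟩ := hZ.exists_subset_card_eq n
      rw [← hFc]
      exact hfin F hF
  · exact iSup_le fun m => Set.encard_image_le _ _

variable {α : Type*} [MeasurableSpace α]

/-- On a compact set |f| attains its minimum, so a zero exists exactly when |f| takes arbitrarily
small values along a dense sequence. This is a countable condition. -/
theorem measurableSet_exists_eq_zero_of_isCompact {f : α → ℝ → ℝ} {K : Set ℝ} (hK : IsCompact K)
    (hf : ∀ t, Measurable fun ω => f ω t) (hc : ∀ ω, ContinuousOn (f ω) K) :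
    MeasurableSet {ω | ∃ t ∈ K, f ω t = 0} := by
  rcases K.eq_empty_or_nonempty with rfl | hne
  · simp
  have : Nonempty K := hne.to_subtype
  have heq : {ω | ∃ t ∈ K, f ω t = 0} =
      ⋂ n : ℕ, ⋃ i : ℕ, {ω | |f ω (TopologicalSpace.denseSeq K i)| < 1 / ((n : ℝ) + 1)} := by
    ext ω
    simp only [Set.mem_ofPred_eq, Set.mem_iInter, Set.mem_iUnion]
    constructor
    · rintro ⟨t, ht, h0⟩ n
      have hcont : Continuous fun x : K => |f ω x| :=
        (continuousOn_iff_continuous_domRestrict.1 (hc ω)).abs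
      have hopen : IsOpen {x : K | |f ω x| < 1 / ((n : ℝ) + 1)} :=
        isOpen_lt hcont continuous_const
      obtain ⟨i, hi⟩ := (TopologicalSpace.denseRange_denseSeq K).exists_mem_open hopen
        ⟨⟨t, ht⟩, by simp only [Set.mem_ofPred_eq, h0, abs_zero]; positivity⟩
      exact ⟨i, hi⟩
    · intro h
      obtain ⟨t, ht, hmin⟩ := hK.exists_isMinOn hne (hc ω).abs
      refine ⟨t, ht, ?_⟩
      by_contra h0
      obtain ⟨n, hn⟩ := exists_nat_one_div_lt (abs_pos.2 h0)
      obtain ⟨i, hi⟩ := h n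
      have := hmin (TopologicalSpace.denseSeq K i).2
      simp only [Set.mem_ofPred_eq] at this
      linarith
  rw [heq]
  exact MeasurableSet.iInter fun n => MeasurableSet.iUnion fun i =>
    measurableSet_lt ((hf _).abs) measurable_const

theorem measurableSet_exists_eq_zero_of_isSigmaCompact {f : α → ℝ → ℝ} {K : Set ℝ}
    (hK : IsSigmaCompact K) (hf : ∀ t, Measurable fun ω => f ω t)
    (hc : ∀ ω, ContinuousOn (f ω) K) :
    MeasurableSet {ω | ∃ t ∈ K, f ω t = 0} := by
  obtain ⟨L, hL, rfl⟩ := hK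
  have : {ω | ∃ t ∈ ⋃ n, L n, f ω t = 0} = ⋃ n, {ω | ∃ t ∈ L n, f ω t = 0} := by
    ext ω
    simp only [Set.mem_iUnion, Set.mem_ofPred_eq]
    tauto
  rw [this]
  exact MeasurableSet.iUnion fun n => measurableSet_exists_eq_zero_of_isCompact (hL n) hf
    fun ω => (hc ω).mono (Set.subset_iUnion L n)

theorem IsOpen.isSigmaCompact_of_real {U : Set ℝ} (hU : IsOpen U) : IsSigmaCompact U := by
  obtain ⟨F, hF, -, hFU, -⟩ := hU.exists_iUnion_isClosed
  rw [← hFU]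
  exact isSigmaCompact_iUnion _ fun n =>
    isSigmaCompact_univ.of_isClosed_subset (hF n) (Set.subset_univ _)

/-- The number of zeros in an open set of a random continuous function is measurable. -/
theorem measurable_encard_zeros {f : α → ℝ → ℝ} {s : Set ℝ} (hs : IsOpen s)
    (hf : ∀ t, Measurable fun ω => f ω t) (hc : ∀ ω, ContinuousOn (f ω) s) :
    Measurable fun ω => ({t | t ∈ s ∧ f ω t = 0}.encard : ℝ≥0∞) := by
  have h1 : ∀ m : ℕ, Measurable fun ω =>
      ((fun t : ℝ => ⌊(m : ℝ) * t⌋) '' {t | t ∈ s ∧ f ω t = 0}).encard := by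
    intro m
    refine measurable_encard.comp ?_
    rw [measurable_set_iff]
    intro j
    apply measurableSet_setOfPred.1
    have hset : {ω | j ∈ (fun t : ℝ => ⌊(m : ℝ) * t⌋) '' {t | t ∈ s ∧ f ω t = 0}} =
        {ω | ∃ t ∈ s ∩ {t : ℝ | ⌊(m : ℝ) * t⌋ = j}, f ω t = 0} := by
      ext ω
      simp only [Set.mem_image, Set.mem_ofPred_eq, Set.mem_inter_iff]
      constructor
      · rintro ⟨t, ⟨h1, h2⟩, h3⟩
        exact ⟨t, ⟨h1, h3⟩, h2⟩
      · rintro ⟨t, ⟨h1, h2⟩, h3⟩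
        exact ⟨t, ⟨h1, h3⟩, h2⟩
    rw [hset]
    refine measurableSet_exists_eq_zero_of_isSigmaCompact ?_ hf
      fun ω => (hc ω).mono Set.inter_subset_left
    -- The cell is half-open: an open set, which is σ-compact, intersected with a closed one.
    have hcell : s ∩ {t : ℝ | ⌊(m : ℝ) * t⌋ = j} =
        (s ∩ {t : ℝ | (m : ℝ) * t < j + 1}) ∩ {t : ℝ | (j : ℝ) ≤ (m : ℝ) * t} := by
      ext t
      simp only [Set.mem_inter_iff, Set.mem_ofPred_eq, Int.floor_eq_iff]
      tauto
    have hclosed : IsClosed {t : ℝ | (j : ℝ) ≤ (m : ℝ) * t} :=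
      isClosed_le continuous_const (by fun_prop)
    obtain ⟨L, hL, hLU⟩ := (hs.inter (isOpen_lt (by fun_prop) continuous_const) :
      IsOpen (s ∩ {t : ℝ | (m : ℝ) * t < j + 1})).isSigmaCompact_of_real
    rw [hcell, ← hLU, Set.iUnion_inter]
    exact isSigmaCompact_iUnion_of_isCompact _ fun n => (hL n).inter_right hclosed
  simp_rw [encard_eq_iSup_encard_image_floor, ENat.toENNReal_iSup]
  exact Measurable.iSup fun m =>
    (measurable_of_countable (fun k : ℕ∞ => (k : ℝ≥0∞))).comp (h1 m)

end CountMeasurable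

/-! ### Crossings of an independent Gaussian level. -/

section Crossings

variable {Ω E : Type*} [MeasurableSpace Ω] [MeasurableSpace E] {P : Measure Ω}
  [IsProbabilityMeasure P]

/-- The mean number of crossings of a random level with standard Gaussian law, by an independent
random function. -/
theorem lintegral_encard_crossings {ξ : Ω → ℝ} {r : Ω → E} (hξ : Measurable ξ) (hr : Measurable r)
    (hlaw : P.map ξ = gaussianReal 0 1) (hind : IndepFun ξ r P) {h h' : E → ℝ → ℝ} {s : Set ℝ}
    (hs : IsOpen s) (hm : Measurable (Function.uncurry h)) (hm' : Measurable (Function.uncurry h'))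
    (hd : ∀ e, ∀ t ∈ s, HasDerivAt (h e) (h' e t) t) (hc : ∀ e, ContinuousOn (h' e) s) :
    ∫⁻ ω, ({t | t ∈ s ∧ h (r ω) t = ξ ω}.encard : ℝ≥0∞) ∂P =
      ∫⁻ t in s, ∫⁻ ω, gaussianPDF 0 1 (h (r ω) t) * ENNReal.ofReal |h' (r ω) t| ∂P := by
  have hG : Measurable fun p : ℝ × E => ({t | t ∈ s ∧ h p.2 t = p.1}.encard : ℝ≥0∞) := by
    have := measurable_encard_zeros (α := ℝ × E) (f := fun p t => h p.2 t - p.1) hs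
      (fun t => (hm.comp (measurable_snd.prodMk measurable_const)).sub measurable_fst)
      (fun p => ContinuousOn.sub (fun t ht => (hd p.2 t ht).continuousAt.continuousWithinAt)
        continuousOn_const)
    simpa only [sub_eq_zero] using this
  have hprob : IsProbabilityMeasure (P.map r) := Measure.isProbabilityMeasure_map hr.aemeasurable
  have hjoint : Measurable (Function.uncurry fun (e : E) (t : ℝ) =>
      gaussianPDF 0 1 (h e t) * ENNReal.ofReal |h' e t|) := by
    have h1 := (measurable_gaussianPDF 0 1).comp hm
    have h2 := ENNReal.measurable_ofReal.comp (measurable_abs.comp hm')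
    exact h1.mul h2
  -- By independence the level is integrated first with `r` frozen; its density is then the weight
  -- in the area formula.
  calc ∫⁻ ω, ({t | t ∈ s ∧ h (r ω) t = ξ ω}.encard : ℝ≥0∞) ∂P
      = ∫⁻ p, ({t | t ∈ s ∧ h p.2 t = p.1}.encard : ℝ≥0∞) ∂(P.map fun ω => (ξ ω, r ω)) := by
        rw [lintegral_map hG (hξ.prodMk hr)]
    _ = ∫⁻ e, ∫⁻ y, ({t | t ∈ s ∧ h e t = y}.encard : ℝ≥0∞) ∂(gaussianReal 0 1) ∂(P.map r) := by
        rw [(indepFun_iff_map_prod_eq_prod_map_map hξ.aemeasurable hr.aemeasurable).1 hind, hlaw,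
          lintegral_prod_symm' _ hG]
    _ = ∫⁻ e, (∫⁻ t in s, gaussianPDF 0 1 (h e t) * ENNReal.ofReal |h' e t|) ∂(P.map r) := by
        refine lintegral_congr fun e => ?_
        have hGe : Measurable fun y => ({t | t ∈ s ∧ h e t = y}.encard : ℝ≥0∞) :=
          hG.comp (measurable_id.prodMk measurable_const)
        rw [gaussianReal_of_var_ne_zero 0 one_ne_zero,
          lintegral_withDensity_eq_lintegral_mul _ (measurable_gaussianPDF 0 1) hGe]
        exact lintegral_mul_encard_eq_lintegral_abs_deriv hs (hd e) (hc e)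
          (measurable_gaussianPDF 0 1)
    _ = ∫⁻ t in s, (∫⁻ e, gaussianPDF 0 1 (h e t) * ENNReal.ofReal |h' e t| ∂(P.map r)) :=
        lintegral_lintegral_swap hjoint.aemeasurable
    _ = _ := by
        congr 1
        ext t
        have ht : Measurable fun e => gaussianPDF 0 1 (h e t) * ENNReal.ofReal |h' e t| :=
          hjoint.of_uncurry_right
        rw [lintegral_map ht hr]

end Crossings

/-! ### Gaussian integrals. -/

section GaussianMoments

open Real

theorem lintegral_abs_gaussianReal_zero_one :
    ∫⁻ x, ENNReal.ofReal |x| ∂(gaussianReal 0 1) = ENNReal.ofReal (√(2 / π)) := by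
  have hint : Integrable (fun x : ℝ => |x|) (gaussianReal 0 1) :=
    ((memLp_id_gaussianReal' (μ := 0) (v := 1) 1 (by norm_num)).integrable le_rfl).abs
  rw [← ofReal_integral_eq_lintegral_ofReal hint (Eventually.of_forall fun x => abs_nonneg x),
    integral_gaussianReal_eq_integral_smul one_ne_zero]
  congr 1
  have h1 : ∀ x : ℝ, gaussianPDFReal 0 1 x • |x| =
      (fun y : ℝ => (√(2 * π))⁻¹ * (y ^ (1 : ℝ) * rexp (-(1 / 2) * y ^ (2 : ℝ)))) |x| := by
    intro x
    simp only [gaussianPDFReal, smul_eq_mul, NNReal.coe_one, mul_one, sub_zero, rpow_one, rpow_two,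
      sq_abs]
    rw [show -x ^ 2 / 2 = -(1 / 2) * x ^ 2 by ring]
    ring
  rw [integral_congr_ae (Eventually.of_forall h1), integral_comp_abs
    (f := fun y : ℝ => (√(2 * π))⁻¹ * (y ^ (1 : ℝ) * rexp (-(1 / 2) * y ^ (2 : ℝ)))),
    integral_const_mul,
    integral_rpow_mul_exp_neg_mul_rpow (by norm_num) (by norm_num) (by norm_num)]
  norm_num
  have h2 : √2 * √2 = 2 := mul_self_sqrt (by norm_num)
  have h3 : √2 ≠ 0 := by positivity
  field_simp
  nlinarith

theorem lintegral_abs_gaussianReal (v : NNReal) :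
    ∫⁻ x, ENNReal.ofReal |x| ∂(gaussianReal 0 v) = ENNReal.ofReal (√(2 * v / π)) := by
  have hv : gaussianReal 0 v = (gaussianReal 0 1).map (√v * ·) := by
    rw [gaussianReal_map_const_mul, mul_zero, mul_one]
    congr 1
    ext
    simp
  rw [hv, lintegral_map (by fun_prop) (by fun_prop)]
  simp_rw [abs_mul, ENNReal.ofReal_mul (abs_nonneg _)]
  rw [lintegral_const_mul _ (by fun_prop), lintegral_abs_gaussianReal_zero_one,
    ← ENNReal.ofReal_mul (abs_nonneg _), abs_of_nonneg (sqrt_nonneg _),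
    ← sqrt_mul (by positivity)]
  congr 2
  ring

/-- Weighting a centred Gaussian law with the standard Gaussian density gives a multiple of a
centred Gaussian law. -/
theorem lintegral_gaussianPDF_mul_gaussianReal (v : NNReal) {g : ℝ → ℝ≥0∞} (hg : Measurable g) :
    ∫⁻ x, gaussianPDF 0 1 x * g x ∂(gaussianReal 0 v) =
      ENNReal.ofReal (√(2 * π * (1 + v)))⁻¹ * ∫⁻ x, g x ∂(gaussianReal 0 (v / (1 + v))) := by
  by_cases hv : v = 0
  · subst hv
    simp [gaussianPDF, gaussianPDFReal]
  have hv' : v / (1 + v) ≠ 0 := by positivity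
  have hvpos : (0 : ℝ) < v := by positivity
  rw [gaussianReal_of_var_ne_zero 0 hv, gaussianReal_of_var_ne_zero 0 hv',
    lintegral_withDensity_eq_lintegral_mul _ (measurable_gaussianPDF 0 v) (by fun_prop),
    lintegral_withDensity_eq_lintegral_mul _ (measurable_gaussianPDF 0 _) hg,
    ← lintegral_const_mul _ (by fun_prop)]
  congr 1
  ext x
  simp only [Pi.mul_apply, ← mul_assoc]
  congr 1
  simp only [gaussianPDF]
  rw [← ENNReal.ofReal_mul (gaussianPDFReal_nonneg _ _ _),
    ← ENNReal.ofReal_mul (by positivity)]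
  congr 1
  simp only [gaussianPDFReal, sub_zero, NNReal.coe_one, mul_one, NNReal.coe_div, NNReal.coe_add]
  have e1 : rexp (-x ^ 2 / (2 * v)) * rexp (-x ^ 2 / 2) =
      rexp (-x ^ 2 / (2 * (v / (1 + v)))) := by
    rw [← Real.exp_add]
    congr 1
    field_simp
    ring
  have e2 : (√(2 * π * v))⁻¹ * (√(2 * π))⁻¹ =
      (√(2 * π * (1 + v)))⁻¹ * (√(2 * π * (v / (1 + v))))⁻¹ := by
    rw [← mul_inv, ← mul_inv, ← sqrt_mul (by positivity), ← sqrt_mul (by positivity)]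
    congr 2
    field_simp
  rw [← e1]
  linear_combination (rexp (-x ^ 2 / (2 * v)) * rexp (-x ^ 2 / 2)) * e2

variable {Ω : Type*} [MeasurableSpace Ω] {P : Measure Ω}

/-- A Gaussian integral that comes up in the Kac-Rice formula. -/
theorem lintegral_gaussianPDF_mul_abs {X Y : Ω → ℝ}
    (hXY : HasGaussianLaw (fun ω => (X ω, Y ω)) P) (hX : ∫ ω, X ω ∂P = 0) (hY : ∫ ω, Y ω ∂P = 0) :
    ∫⁻ ω, gaussianPDF 0 1 (X ω) * ENNReal.ofReal |Y ω| ∂P =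
      ENNReal.ofReal (1 / π * √((1 + ∫ ω, X ω ^ 2 ∂P) * ∫ ω, Y ω ^ 2 ∂P - (∫ ω, X ω * Y ω ∂P) ^ 2) /
        (1 + ∫ ω, X ω ^ 2 ∂P)) := by
  have hP := hXY.isProbabilityMeasure
  have hX2 : MemLp X 2 P := hXY.fst.memLp_two
  have hY2 : MemLp Y 2 P := hXY.snd.memLp_two
  set v : ℝ := ∫ ω, X ω ^ 2 ∂P with hv
  set c : ℝ := ∫ ω, X ω * Y ω ∂P with hc
  set w : ℝ := ∫ ω, Y ω ^ 2 ∂P with hw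
  have hv0 : 0 ≤ v := integral_nonneg fun ω => sq_nonneg _
  -- If v = 0, then X = 0 almost everywhere and c = 0, so β v = c survives the convention c / 0 = 0.
  have hcv : c ^ 2 / v * v = c ^ 2 := by
    by_cases h : v = 0
    · have : (fun ω => X ω ^ 2) =ᵐ[P] 0 :=
        (integral_eq_zero_iff_of_nonneg (fun ω => sq_nonneg _) hX2.integrable_sq).1 h
      have hc0 : c = 0 := by
        rw [hc]
        apply integral_eq_zero_of_ae
        filter_upwards [this] with ω hω
        have : X ω = 0 := by simpa using hω
        simp [this]
      simp [hc0]
    · field_simp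
  -- Regression of Y on X: the residual `W` = Y - βX is uncorrelated with X, hence independent of
  -- it.
  set β : ℝ := c / v with hβ
  have hβv : β * v = c := by
    by_cases h : v = 0
    · have hc0 : c = 0 := by
        rw [h, mul_zero] at hcv
        exact pow_eq_zero_iff two_ne_zero |>.1 hcv.symm
      rw [h, mul_zero, hc0]
    · rw [hβ]; field_simp
  clear_value β
  have hXYi : Integrable (fun ω => X ω * Y ω) P := hX2.integrable_mul hY2
  set W : Ω → ℝ := fun ω => Y ω - β * X ω with hW
  have hXW : HasGaussianLaw (fun ω => (X ω, W ω)) P := by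
    have := hXY.map_fun ((ContinuousLinearMap.fst ℝ ℝ ℝ).prod
      (ContinuousLinearMap.snd ℝ ℝ ℝ - β • ContinuousLinearMap.fst ℝ ℝ ℝ))
    simpa using this
  have hW2 : MemLp W 2 P := hXW.snd.memLp_two
  have hW0 : ∫ ω, W ω ∂P = 0 := by
    rw [hW, integral_sub hXY.snd.integrable (hXY.fst.integrable.const_mul β), integral_const_mul,
      hX, hY]
    simp
  have hcov : cov[X, W; P] = 0 := by
    rw [covariance_eq_sub hX2 hW2, hX, zero_mul, sub_zero]
    have : ∫ ω, (X * W) ω ∂P = ∫ ω, (X ω * Y ω - β * X ω ^ 2) ∂P := by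
      congr 1
      ext ω
      simp only [hW, Pi.mul_apply]
      ring
    rw [this, integral_sub hXYi (hX2.integrable_sq.const_mul β), integral_const_mul, ← hv, ← hc,
      hβv, sub_self]
  have hind : IndepFun X W P := hXW.indepFun_of_covariance_eq_zero hcov
  have hvarX : Var[X; P] = v := by
    rw [variance_eq_sub hX2, hX]
    simp [hv]
  have hτ : ∫ ω, W ω ^ 2 ∂P = w - β * c := by
    have : ∫ ω, W ω ^ 2 ∂P = ∫ ω, (Y ω ^ 2 - (2 * β * (X ω * Y ω) - β ^ 2 * X ω ^ 2)) ∂P := by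
      congr 1
      ext ω
      simp only [hW]
      ring
    have i1 := hXYi.const_mul (2 * β)
    have i2 := hX2.integrable_sq.const_mul (β ^ 2)
    have i3 : Integrable (fun ω => 2 * β * (X ω * Y ω) - β ^ 2 * X ω ^ 2) P := i1.sub i2
    rw [this, integral_sub hY2.integrable_sq i3, integral_sub i1 i2, integral_const_mul,
      integral_const_mul, ← hv, ← hc, ← hw]
    linear_combination β * hβv
  have hvarW : Var[W; P] = w - β * c := by
    rw [variance_eq_sub hW2, hW0, ← hτ]
    simp
  have hτ0 : 0 ≤ w - β * c := hτ ▸ integral_nonneg fun ω => sq_nonneg _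
  have hlawX : P.map X = gaussianReal 0 v.toNNReal := by
    rw [hXW.fst.map_eq_gaussianReal, hX, hvarX]
  have hlawW : P.map W = gaussianReal 0 (w - β * c).toNNReal := by
    rw [hXW.snd.map_eq_gaussianReal, hW0, hvarW]
  set V := v.toNNReal with hV
  set τ := (w - β * c).toNNReal with hτdef
  have hVc : (V : ℝ) = v := Real.coe_toNNReal _ hv0
  have hτc : (τ : ℝ) = w - β * c := Real.coe_toNNReal _ hτ0
  have hmeas : Measurable fun p : ℝ × ℝ => gaussianPDF 0 1 p.1 * ENNReal.ofReal |p.2 + β * p.1| :=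
    by fun_prop
  calc ∫⁻ ω, gaussianPDF 0 1 (X ω) * ENNReal.ofReal |Y ω| ∂P
      = ∫⁻ p, gaussianPDF 0 1 p.1 * ENNReal.ofReal |p.2 + β * p.1|
          ∂(P.map fun ω => (X ω, W ω)) := by
        rw [lintegral_map' hmeas.aemeasurable hXW.aemeasurable]
        simp [hW]
    _ = ∫⁻ y, ∫⁻ x, gaussianPDF 0 1 x * ENNReal.ofReal |y + β * x| ∂(gaussianReal 0 V)
          ∂(gaussianReal 0 τ) := by
        rw [(indepFun_iff_map_prod_eq_prod_map_map hXW.fst.aemeasurable hXW.snd.aemeasurable).1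
          hind, hlawX, hlawW, lintegral_prod_symm' _ hmeas]
    -- The density weight shrinks the variance of X from V to V/(1 + V), after which only the mean
    -- of |N| for one centred Gaussian N remains.
    _ = ENNReal.ofReal (√(2 * π * (1 + V)))⁻¹ * ∫⁻ y, ∫⁻ x, ENNReal.ofReal |y + β * x|
          ∂(gaussianReal 0 (V / (1 + V))) ∂(gaussianReal 0 τ) := by
        rw [← lintegral_const_mul _ (Measurable.lintegral_prod_right (by fun_prop))]
        congr 1
        ext y
        rw [lintegral_gaussianPDF_mul_gaussianReal V
          (g := fun x => ENNReal.ofReal |y + β * x|) (by fun_prop)]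
    _ = ENNReal.ofReal (√(2 * π * (1 + V)))⁻¹ * ∫⁻ y, ∫⁻ x, ENNReal.ofReal |y + x|
          ∂(gaussianReal 0 (.mk (β ^ 2) (sq_nonneg _) * (V / (1 + V)))) ∂(gaussianReal 0 τ) := by
        congr 2
        ext y
        have := gaussianReal_map_const_mul (μ := 0) (v := V / (1 + V)) β
        rw [mul_zero] at this
        rw [← this, lintegral_map (by fun_prop) (by fun_prop)]
    _ = ENNReal.ofReal (√(2 * π * (1 + V)))⁻¹ * ∫⁻ x, ENNReal.ofReal |x|
          ∂(gaussianReal 0 (τ + .mk (β ^ 2) (sq_nonneg _) * (V / (1 + V)))) := by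
        have := gaussianReal_conv_gaussianReal (m₁ := 0) (m₂ := 0) (v₁ := τ)
          (v₂ := .mk (β ^ 2) (sq_nonneg _) * (V / (1 + V)))
        rw [add_zero] at this
        rw [← this, Measure.lintegral_conv (by fun_prop)]
    _ = _ := by
        rw [lintegral_abs_gaussianReal, ← ENNReal.ofReal_mul (by positivity)]
        congr 1
        push_cast
        simp only [hVc, hτc]
        have hpos : 0 < 1 + v := by linarith
        have hs : w - β * c + β ^ 2 * (v / (1 + v)) = ((1 + v) * w - c ^ 2) / (1 + v) := by
          field_simp
          linear_combination (β - c) * hβv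
        rw [hs]
        have e : 2 * (((1 + v) * w - c ^ 2) / (1 + v)) / π =
          (2 * π * (1 + v)) * (((1 + v) * w - c ^ 2) / (π * (1 + v)) ^ 2) := by
          field_simp
        rw [e, sqrt_mul (x := 2 * π * (1 + v)) (by positivity), sqrt_div' _ (by positivity),
          sqrt_sq (by positivity), ← mul_assoc, inv_mul_cancel₀ (by positivity)]
        field_simp

end GaussianMoments

/-! ### Joint Gaussianity of two independent processes. -/

section JointlyGaussian

variable {Ω : Type*} [MeasurableSpace Ω] {P : Measure Ω}

/-- A finite set of indices splits into a left and a right part; two independent Gaussian vectors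
are jointly Gaussian, and a linear map reassembles them. -/
theorem IsGaussianProcess.sumElim_of_indepFun {S T : Type*} {X : S → Ω → ℝ} {Y : T → Ω → ℝ}
    (hX : IsGaussianProcess X P) (hY : IsGaussianProcess Y P)
    (h : IndepFun (fun ω s => X s ω) (fun ω t => Y t ω) P) :
    IsGaussianProcess (Sum.elim X Y) P where
  hasGaussianLaw I := by
    classical
    have h1 : IndepFun (fun ω => I.toLeft.restrict (X · ω)) (fun ω => I.toRight.restrict (Y · ω)) P :=
      h.comp (φ := I.toLeft.restrict) (ψ := I.toRight.restrict)
        (Finset.measurable_restrict _) (Finset.measurable_restrict _)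
    have h2 := h1.hasGaussianLaw (hX.hasGaussianLaw I.toLeft) (hY.hasGaussianLaw I.toRight)
    let K : ((I.toLeft → ℝ) × (I.toRight → ℝ)) →L[ℝ] I → ℝ :=
      ContinuousLinearMap.pi fun i => match i with
        | ⟨Sum.inl s, hs⟩ => (ContinuousLinearMap.proj (R := ℝ) (φ := fun _ : I.toLeft => ℝ)
            ⟨s, Finset.mem_toLeft.2 hs⟩).comp (ContinuousLinearMap.fst ℝ _ _)
        | ⟨Sum.inr t, ht⟩ => (ContinuousLinearMap.proj (R := ℝ) (φ := fun _ : I.toRight => ℝ)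
            ⟨t, Finset.mem_toRight.2 ht⟩).comp (ContinuousLinearMap.snd ℝ _ _)
    have h3 := h2.map_fun K
    have h4 : (fun ω => I.restrict (Sum.elim X Y · ω)) =
        fun ω => K (I.toLeft.restrict (X · ω), I.toRight.restrict (Y · ω)) := by
      funext ω i
      rcases i with ⟨s | t, hi⟩ <;> rfl
    rw [h4]
    exact h3

theorem IsGaussianProcess.sum_mul {S T : Type*} {Z : T → Ω → ℝ} (hZ : IsGaussianProcess Z P)
    (J : S → Finset T) (c : S → T → ℝ) :
    IsGaussianProcess (fun s ω => ∑ i ∈ J s, c s i * Z i ω) P := by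
  refine hZ.of_isGaussianProcess fun s => ⟨J s, ∑ i : J s, c s i • ContinuousLinearMap.proj i, ?_⟩
  intro ω
  simp [← Finset.sum_attach (J s)]

end JointlyGaussian

/-! ### Linear forms in the coefficients. -/

section LinearForms

variable {Ω : Type*}

/-- The linear form `∑_{k < n} (p_k a_k + q_k b_k)` in the random coefficients. -/
noncomputable def linForm (a b : ℕ → Ω → ℝ) (n : ℕ) (p q : ℕ → ℝ) (ω : Ω) : ℝ :=
  ∑ k ∈ Finset.range n, (p k * a k ω + q k * b k ω)

theorem linForm_eq_sum_disjSum (a b : ℕ → Ω → ℝ) (n : ℕ) (p q : ℕ → ℝ) (ω : Ω) :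
    linForm a b n p q ω = ∑ i ∈ (Finset.range n).disjSum (Finset.range n),
      Sum.elim p q i * Sum.elim a b i ω := by
  simp [linForm, Finset.sum_disjSum, Finset.sum_add_distrib]

theorem linForm_single (a b : ℕ → Ω → ℝ) {n : ℕ} (hn : 1 ≤ n) :
    linForm a b n (Pi.single 0 1) 0 = a 0 := by
  ext ω
  simp only [linForm, Pi.zero_apply, zero_mul, add_zero]
  rw [Finset.sum_eq_single_of_mem 0 (Finset.mem_range.2 hn)]
  · simp
  · intro k _ hk
    simp [hk]

variable [MeasurableSpace Ω] {P : Measure Ω}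

theorem isGaussianProcess_linForm {S : Type*} {a b : ℕ → Ω → ℝ}
    (hab : IsGaussianProcess (Sum.elim a b) P) (n : ℕ) (p q : S → ℕ → ℝ) :
    IsGaussianProcess (fun s => linForm a b n (p s) (q s)) P := by
  have := IsGaussianProcess.sum_mul hab
    (fun _ : S => (Finset.range n).disjSum (Finset.range n)) (fun s => Sum.elim (p s) (q s))
  convert this using 2 with s
  ext ω
  exact linForm_eq_sum_disjSum a b n (p s) (q s) ω

variable {ρ : ℕ → ℝ} {a b : ℕ → Ω → ℝ}

theorem IsStandardStationaryGaussian.memLp (ha : IsStandardStationaryGaussian P ρ a) (k : ℕ) :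
    MemLp (a k) 2 P := (ha.gaussian.hasGaussianLaw_eval k).memLp_two

theorem integral_mul_eq_zero_of_indepFun (ha : IsStandardStationaryGaussian P ρ a)
    (hb : IsStandardStationaryGaussian P ρ b)
    (hab : IndepFun (fun ω k => a k ω) (fun ω k => b k ω) P) (k l : ℕ) :
    ∫ ω, a k ω * b l ω ∂P = 0 := by
  have h : IndepFun (a k) (b l) P :=
    hab.comp (φ := fun x : ℕ → ℝ => x k) (ψ := fun x : ℕ → ℝ => x l)
      (measurable_pi_apply k) (measurable_pi_apply l)
  have := h.integral_mul_eq_mul_integral (ha.memLp k).1 (hb.memLp l).1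
  simpa [ha.mean_zero k] using this

theorem memLp_linForm (ha : IsStandardStationaryGaussian P ρ a)
    (hb : IsStandardStationaryGaussian P ρ b) (n : ℕ) (p q : ℕ → ℝ) :
    MemLp (linForm a b n p q) 2 P := by
  have : linForm a b n p q = fun ω => ∑ k ∈ Finset.range n, (p k * a k ω + q k * b k ω) := rfl
  rw [this]
  exact memLp_finsetSum _ fun k _ => ((ha.memLp k).const_mul _).add ((hb.memLp k).const_mul _)

theorem integral_linForm (ha : IsStandardStationaryGaussian P ρ a)
    (hb : IsStandardStationaryGaussian P ρ b) (n : ℕ) (p q : ℕ → ℝ) :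
    ∫ ω, linForm a b n p q ω ∂P = 0 := by
  have ia : ∀ k, Integrable (a k) P := fun k => (ha.gaussian.hasGaussianLaw_eval k).integrable
  have ib : ∀ k, Integrable (b k) P := fun k => (hb.gaussian.hasGaussianLaw_eval k).integrable
  simp only [linForm]
  have iab : ∀ k, Integrable (fun ω => p k * a k ω + q k * b k ω) P := fun k =>
    ((ia k).const_mul _).add ((ib k).const_mul _)
  rw [integral_finsetSum _ fun k _ => iab k]
  apply Finset.sum_eq_zero
  intro k _
  rw [integral_add ((ia k).const_mul _) ((ib k).const_mul _), integral_const_mul,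
    integral_const_mul, ha.mean_zero, hb.mean_zero]
  simp

/-- The mixed terms a_k b_l vanish by independence, and both families have the same correlation ρ.
-/
theorem integral_linForm_mul_linForm (ha : IsStandardStationaryGaussian P ρ a)
    (hb : IsStandardStationaryGaussian P ρ b)
    (hab : IndepFun (fun ω k => a k ω) (fun ω k => b k ω) P) (n : ℕ) (p q p' q' : ℕ → ℝ) :
    ∫ ω, linForm a b n p q ω * linForm a b n p' q' ω ∂P =
      ∑ k ∈ Finset.range n, ∑ l ∈ Finset.range n,
        (p k * p' l + q k * q' l) * ρ ((k : ℤ) - (l : ℤ)).natAbs := by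
  have haa : ∀ k l, Integrable (fun ω => a k ω * a l ω) P := fun k l =>
    (ha.memLp k).integrable_mul (ha.memLp l)
  have hbb : ∀ k l, Integrable (fun ω => b k ω * b l ω) P := fun k l =>
    (hb.memLp k).integrable_mul (hb.memLp l)
  have hAB : ∀ k l, Integrable (fun ω => a k ω * b l ω) P := fun k l =>
    (ha.memLp k).integrable_mul (hb.memLp l)
  have hexp : ∀ k l, (fun ω => (p k * a k ω + q k * b k ω) * (p' l * a l ω + q' l * b l ω)) =
      fun ω => (p k * p' l) * (a k ω * a l ω) + (q k * q' l) * (b k ω * b l ω) +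
        ((p k * q' l) * (a k ω * b l ω) + (q k * p' l) * (a l ω * b k ω)) := by
    intro k l
    ext ω
    ring
  have i1 : ∀ k l, Integrable (fun ω => (p k * p' l) * (a k ω * a l ω) +
      (q k * q' l) * (b k ω * b l ω)) P := fun k l =>
    ((haa k l).const_mul _).add ((hbb k l).const_mul _)
  have i2 : ∀ k l, Integrable (fun ω => (p k * q' l) * (a k ω * b l ω) +
      (q k * p' l) * (a l ω * b k ω)) P := fun k l =>
    ((hAB k l).const_mul _).add ((hAB l k).const_mul _)
  simp only [linForm, Finset.sum_mul_sum]
  have i3 : ∀ k l, Integrable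
      (fun ω => (p k * a k ω + q k * b k ω) * (p' l * a l ω + q' l * b l ω)) P := by
    intro k l
    rw [hexp]
    exact (i1 k l).add (i2 k l)
  rw [integral_finsetSum _ fun k _ => integrable_finsetSum _ fun l _ => i3 k l]
  refine Finset.sum_congr rfl fun k _ => ?_
  rw [integral_finsetSum _ fun l _ => i3 k l]
  refine Finset.sum_congr rfl fun l _ => ?_
  rw [hexp, integral_add (i1 k l) (i2 k l),
    integral_add ((haa k l).const_mul _) ((hbb k l).const_mul _),
    integral_add ((hAB k l).const_mul _) ((hAB l k).const_mul _)]
  simp only [integral_const_mul, ha.cov, hb.cov, integral_mul_eq_zero_of_indepFun ha hb hab]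
  ring

end LinearForms

/-! ### Covariances of f_n, its derivative and the first coefficient. -/

section Covariances

variable {Ω : Type*}

/-- The variance of `f_n(t)`. -/
noncomputable def trigVar (ρ : ℕ → ℝ) (n : ℕ) (t : ℝ) : ℝ :=
  ∑ k ∈ Finset.range n, ∑ l ∈ Finset.range n,
    ρ ((k : ℤ) - (l : ℤ)).natAbs * Real.cos (((k : ℝ) - l) * t)

/-- The covariance of `f_n(t)` and `f_n'(t)`. -/
noncomputable def trigCov (ρ : ℕ → ℝ) (n : ℕ) (t : ℝ) : ℝ :=
  ∑ k ∈ Finset.range n, ∑ l ∈ Finset.range n,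
    ((l : ℝ) + 1) * ρ ((k : ℤ) - (l : ℤ)).natAbs * Real.sin (((k : ℝ) - l) * t)

/-- The variance of `f_n'(t)`. -/
noncomputable def trigDerivVar (ρ : ℕ → ℝ) (n : ℕ) (t : ℝ) : ℝ :=
  ∑ k ∈ Finset.range n, ∑ l ∈ Finset.range n,
    ((k : ℝ) + 1) * ((l : ℝ) + 1) * ρ ((k : ℤ) - (l : ℤ)).natAbs * Real.cos (((k : ℝ) - l) * t)

/-- The derivative of `f_n`. -/
noncomputable def trigPolyDeriv (a b : ℕ → Ω → ℝ) (n : ℕ) (ω : Ω) (t : ℝ) : ℝ :=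
  ∑ k ∈ Finset.range n,
    (a k ω * (-Real.sin (((k : ℝ) + 1) * t) * ((k : ℝ) + 1)) +
      b k ω * (Real.cos (((k : ℝ) + 1) * t) * ((k : ℝ) + 1)))

theorem hasDerivAt_trigPoly (a b : ℕ → Ω → ℝ) (n : ℕ) (ω : Ω) (t : ℝ) :
    HasDerivAt (trigPoly a b n ω) (trigPolyDeriv a b n ω t) t := by
  unfold trigPoly trigPolyDeriv
  apply HasDerivAt.fun_sum
  intro k _
  have h : HasDerivAt (fun t : ℝ => ((k : ℝ) + 1) * t) ((k : ℝ) + 1) t := by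
    simpa using (hasDerivAt_id t).const_mul ((k : ℝ) + 1)
  exact (h.cos.const_mul _).add (h.sin.const_mul _)

theorem continuous_trigPoly (a b : ℕ → Ω → ℝ) (n : ℕ) (ω : Ω) : Continuous (trigPoly a b n ω) := by
  unfold trigPoly
  fun_prop

theorem continuous_trigPolyDeriv (a b : ℕ → Ω → ℝ) (n : ℕ) (ω : Ω) :
    Continuous (trigPolyDeriv a b n ω) := by
  unfold trigPolyDeriv
  fun_prop

theorem trigPoly_eq_linForm (a b : ℕ → Ω → ℝ) (n : ℕ) (t : ℝ) :
    (fun ω => trigPoly a b n ω t) = linForm a b n (fun k => Real.cos (((k : ℝ) + 1) * t))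
      (fun k => Real.sin (((k : ℝ) + 1) * t)) := by
  ext ω
  simp only [trigPoly, linForm]
  exact Finset.sum_congr rfl fun k _ => by ring

theorem trigPolyDeriv_eq_linForm (a b : ℕ → Ω → ℝ) (n : ℕ) (t : ℝ) :
    (fun ω => trigPolyDeriv a b n ω t) =
      linForm a b n (fun k => -Real.sin (((k : ℝ) + 1) * t) * ((k : ℝ) + 1))
        (fun k => Real.cos (((k : ℝ) + 1) * t) * ((k : ℝ) + 1)) := by
  ext ω
  simp only [trigPolyDeriv, linForm]
  exact Finset.sum_congr rfl fun k _ => by ring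

variable [MeasurableSpace Ω] {P : Measure Ω} {ρ : ℕ → ℝ} {a b : ℕ → Ω → ℝ}

theorem integral_trigPoly_sq (ha : IsStandardStationaryGaussian P ρ a)
    (hb : IsStandardStationaryGaussian P ρ b)
    (hab : IndepFun (fun ω k => a k ω) (fun ω k => b k ω) P) (n : ℕ) (t : ℝ) :
    ∫ ω, trigPoly a b n ω t * trigPoly a b n ω t ∂P = trigVar ρ n t := by
  have h := integral_linForm_mul_linForm ha hb hab n (fun k => Real.cos (((k : ℝ) + 1) * t))
      (fun k => Real.sin (((k : ℝ) + 1) * t)) (fun k => Real.cos (((k : ℝ) + 1) * t))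
      (fun k => Real.sin (((k : ℝ) + 1) * t))
  rw [← trigPoly_eq_linForm] at h
  rw [h]
  refine Finset.sum_congr rfl fun k _ => Finset.sum_congr rfl fun l _ => ?_
  rw [show ((k : ℝ) - l) * t = ((k : ℝ) + 1) * t - ((l : ℝ) + 1) * t by ring, Real.cos_sub]
  ring

theorem integral_trigPoly_mul_trigPolyDeriv (ha : IsStandardStationaryGaussian P ρ a)
    (hb : IsStandardStationaryGaussian P ρ b)
    (hab : IndepFun (fun ω k => a k ω) (fun ω k => b k ω) P) (n : ℕ) (t : ℝ) :
    ∫ ω, trigPoly a b n ω t * trigPolyDeriv a b n ω t ∂P = trigCov ρ n t := by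
  have h := integral_linForm_mul_linForm ha hb hab n (fun k => Real.cos (((k : ℝ) + 1) * t))
      (fun k => Real.sin (((k : ℝ) + 1) * t))
      (fun k => -Real.sin (((k : ℝ) + 1) * t) * ((k : ℝ) + 1))
      (fun k => Real.cos (((k : ℝ) + 1) * t) * ((k : ℝ) + 1))
  rw [← trigPoly_eq_linForm, ← trigPolyDeriv_eq_linForm] at h
  rw [h]
  refine Finset.sum_congr rfl fun k _ => Finset.sum_congr rfl fun l _ => ?_
  rw [show ((k : ℝ) - l) * t = ((k : ℝ) + 1) * t - ((l : ℝ) + 1) * t by ring, Real.sin_sub]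
  ring

theorem integral_trigPolyDeriv_sq (ha : IsStandardStationaryGaussian P ρ a)
    (hb : IsStandardStationaryGaussian P ρ b)
    (hab : IndepFun (fun ω k => a k ω) (fun ω k => b k ω) P) (n : ℕ) (t : ℝ) :
    ∫ ω, trigPolyDeriv a b n ω t * trigPolyDeriv a b n ω t ∂P = trigDerivVar ρ n t := by
  have h := integral_linForm_mul_linForm ha hb hab n
      (fun k => -Real.sin (((k : ℝ) + 1) * t) * ((k : ℝ) + 1))
      (fun k => Real.cos (((k : ℝ) + 1) * t) * ((k : ℝ) + 1))
      (fun k => -Real.sin (((k : ℝ) + 1) * t) * ((k : ℝ) + 1))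
      (fun k => Real.cos (((k : ℝ) + 1) * t) * ((k : ℝ) + 1))
  rw [← trigPolyDeriv_eq_linForm] at h
  rw [h]
  refine Finset.sum_congr rfl fun k _ => Finset.sum_congr rfl fun l _ => ?_
  rw [show ((k : ℝ) - l) * t = ((k : ℝ) + 1) * t - ((l : ℝ) + 1) * t by ring, Real.cos_sub]
  ring

/-- The covariance of `f_n(t)` with the first coefficient. -/
noncomputable def trigRegr (ρ : ℕ → ℝ) (n : ℕ) (t : ℝ) : ℝ :=
  ∑ k ∈ Finset.range n, ρ k * Real.cos (((k : ℝ) + 1) * t)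

/-- The covariance of `f_n'(t)` with the first coefficient. -/
noncomputable def trigRegrDeriv (ρ : ℕ → ℝ) (n : ℕ) (t : ℝ) : ℝ :=
  ∑ k ∈ Finset.range n, ρ k * (-Real.sin (((k : ℝ) + 1) * t) * ((k : ℝ) + 1))

theorem integral_coeff_mul_linForm (ha : IsStandardStationaryGaussian P ρ a)
    (hb : IsStandardStationaryGaussian P ρ b)
    (hab : IndepFun (fun ω k => a k ω) (fun ω k => b k ω) P) {n : ℕ} (hn : 1 ≤ n) (p q : ℕ → ℝ) :
    ∫ ω, a 0 ω * linForm a b n p q ω ∂P = ∑ k ∈ Finset.range n, ρ k * p k := by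
  have h := integral_linForm_mul_linForm ha hb hab n (Pi.single 0 1) 0 p q
  rw [linForm_single a b hn] at h
  rw [h, Finset.sum_eq_single_of_mem 0 (Finset.mem_range.2 hn)]
  · simp [mul_comm]
  · intro k _ hk
    simp [hk]

theorem integral_coeff_mul_trigPoly (ha : IsStandardStationaryGaussian P ρ a)
    (hb : IsStandardStationaryGaussian P ρ b)
    (hab : IndepFun (fun ω k => a k ω) (fun ω k => b k ω) P) {n : ℕ} (hn : 1 ≤ n) (t : ℝ) :
    ∫ ω, a 0 ω * trigPoly a b n ω t ∂P = trigRegr ρ n t := by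
  have := integral_coeff_mul_linForm ha hb hab hn (fun k => Real.cos (((k : ℝ) + 1) * t))
    (fun k => Real.sin (((k : ℝ) + 1) * t))
  rwa [← trigPoly_eq_linForm] at this

theorem integral_coeff_mul_trigPolyDeriv (ha : IsStandardStationaryGaussian P ρ a)
    (hb : IsStandardStationaryGaussian P ρ b)
    (hab : IndepFun (fun ω k => a k ω) (fun ω k => b k ω) P) {n : ℕ} (hn : 1 ≤ n) (t : ℝ) :
    ∫ ω, a 0 ω * trigPolyDeriv a b n ω t ∂P = trigRegrDeriv ρ n t := by
  have := integral_coeff_mul_linForm ha hb hab hn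
    (fun k => -Real.sin (((k : ℝ) + 1) * t) * ((k : ℝ) + 1))
    (fun k => Real.cos (((k : ℝ) + 1) * t) * ((k : ℝ) + 1))
  rwa [← trigPolyDeriv_eq_linForm] at this

theorem hasDerivAt_trigRegr (ρ : ℕ → ℝ) (n : ℕ) (t : ℝ) :
    HasDerivAt (trigRegr ρ n) (trigRegrDeriv ρ n t) t := by
  unfold trigRegr trigRegrDeriv
  apply HasDerivAt.fun_sum
  intro k _
  have h : HasDerivAt (fun t : ℝ => ((k : ℝ) + 1) * t) ((k : ℝ) + 1) t := by
    simpa using (hasDerivAt_id t).const_mul ((k : ℝ) + 1)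
  exact h.cos.const_mul _

theorem continuous_trigRegr (ρ : ℕ → ℝ) (n : ℕ) : Continuous (trigRegr ρ n) := by
  unfold trigRegr
  fun_prop

theorem continuous_trigRegrDeriv (ρ : ℕ → ℝ) (n : ℕ) : Continuous (trigRegrDeriv ρ n) := by
  unfold trigRegrDeriv
  fun_prop

end Covariances

/-! ### Orthogonality of cosines. -/

section Orthogonality

open Real

theorem integral_cos_int_mul_add (m : ℤ) (c : ℝ) :
    ∫ x in (0 : ℝ)..(2 * π), cos ((m : ℝ) * x + c) = if m = 0 then 2 * π * cos c else 0 := by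
  split_ifs with h
  · simp [h]
  · have hm : (m : ℝ) ≠ 0 := by exact_mod_cast h
    rw [intervalIntegral.integral_comp_mul_add (fun y => cos y) hm, integral_cos]
    have : sin ((m : ℝ) * (2 * π) + c) = sin (m * 0 + c) := by
      rw [mul_zero, zero_add, add_comm, sin_add_int_mul_two_pi]
    rw [this, sub_self, smul_zero]

/-- For j = m = 0 both indicators equal 1, which accounts for the value 2π cos c. -/
theorem integral_cos_int_mul_cos (j m : ℤ) (c : ℝ) :
    ∫ x in (0 : ℝ)..(2 * π), cos ((j : ℝ) * x) * cos ((m : ℝ) * x + c) =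
      π * cos c * ((if j = m then 1 else 0) + (if j = -m then 1 else 0)) := by
  have h : ∀ x : ℝ, cos ((j : ℝ) * x) * cos ((m : ℝ) * x + c) =
      1 / 2 * (cos (((j + m : ℤ) : ℝ) * x + c) + cos (((j - m : ℤ) : ℝ) * x + -c)) := by
    intro x
    have e1 : ((j + m : ℤ) : ℝ) * x + c = j * x + (m * x + c) := by push_cast; ring
    have e2 : ((j - m : ℤ) : ℝ) * x + -c = j * x - (m * x + c) := by push_cast; ring
    rw [e1, e2, cos_add (j * x), cos_sub (j * x)]
    ring
  simp_rw [h]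
  rw [intervalIntegral.integral_const_mul, intervalIntegral.integral_add
    (by apply Continuous.intervalIntegrable; fun_prop)
    (by apply Continuous.intervalIntegrable; fun_prop), integral_cos_int_mul_add,
    integral_cos_int_mul_add, cos_neg]
  simp only [add_eq_zero_iff_eq_neg, sub_eq_zero]
  split_ifs <;> ring

end Orthogonality

/-! ### Zeros of the regression function. -/

section ZeroSet

/-- The coefficient of cos t is ρ(0) = 1, and integration against cos isolates it. -/
theorem trigRegr_exists_ne_zero {ρ : ℕ → ℝ} (h0 : ρ 0 = 1) {n : ℕ} (hn : 1 ≤ n) :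
    ∃ t, trigRegr ρ n t ≠ 0 := by
  by_contra! hall
  have h1 : ∫ x in (0 : ℝ)..(2 * Real.pi), trigRegr ρ n x * Real.cos x = 0 := by simp [hall]
  have h2 : ∀ x, trigRegr ρ n x * Real.cos x = ∑ k ∈ Finset.range n,
      ρ k * (Real.cos (((k + 1 : ℤ) : ℝ) * x) * Real.cos (((1 : ℤ) : ℝ) * x + 0)) := by
    intro x
    simp only [trigRegr, Finset.sum_mul]
    refine Finset.sum_congr rfl fun k _ => ?_
    push_cast
    ring_nf
  simp_rw [h2] at h1
  rw [intervalIntegral.integral_finsetSum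
    (fun k _ => by apply Continuous.intervalIntegrable; fun_prop)] at h1
  simp_rw [intervalIntegral.integral_const_mul, integral_cos_int_mul_cos] at h1
  rw [Finset.sum_eq_single_of_mem 0 (Finset.mem_range.2 hn)] at h1
  · simp [h0, Real.pi_ne_zero] at h1
  · intro k _ hk
    rw [if_neg (by omega), if_neg (by omega)]
    simp

/-- An analytic function that is not identically zero has a discrete zero set, and discrete subsets
of the line are countable. -/
theorem countable_zeros_trigRegr {ρ : ℕ → ℝ} (h0 : ρ 0 = 1) {n : ℕ} (hn : 1 ≤ n) :
    {t | trigRegr ρ n t = 0}.Countable := by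
  obtain ⟨t, ht⟩ := trigRegr_exists_ne_zero h0 hn
  have han : AnalyticOnNhd ℝ (trigRegr ρ n) Set.univ := by
    intro x _
    unfold trigRegr
    fun_prop
  have hcod := han.preimage_zero_mem_codiscrete ht
  have hd : IsDiscrete {t | trigRegr ρ n t = 0} := by
    have := isDiscrete_of_codiscreteWithin (U := Set.univ) (s := {t | trigRegr ρ n t = 0}) hcod
    rwa [Set.inter_univ] at this
  have : DiscreteTopology {t | trigRegr ρ n t = 0} := hd.to_subtype
  exact TopologicalSpace.separableSpace_iff_countable.1 inferInstance

end ZeroSet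

/-! ### The Kac-Rice formula. -/

section KacRice

variable {Ω : Type*} [MeasurableSpace Ω] {P : Measure Ω} {ρ : ℕ → ℝ} {a b : ℕ → Ω → ℝ}

/-- A nondegenerate Gaussian law has no atoms. This discards the countably many points at which the
regression argument fails. -/
theorem trigPoly_ae_ne_zero (ha : IsStandardStationaryGaussian P ρ a)
    (hb : IsStandardStationaryGaussian P ρ b)
    (hab : IndepFun (fun ω k => a k ω) (fun ω k => b k ω) P) {n : ℕ} {t : ℝ}
    (hV : 0 < trigVar ρ n t) : ∀ᵐ ω ∂P, trigPoly a b n ω t ≠ 0 := by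
  have hG := IsGaussianProcess.sumElim_of_indepFun ha.gaussian hb.gaussian hab
  have hP := ha.gaussian.isProbabilityMeasure
  have hf : HasGaussianLaw (fun ω => trigPoly a b n ω t) P := by
    rw [trigPoly_eq_linForm]
    exact (isGaussianProcess_linForm (S := Unit) hG n (fun _ k => Real.cos (((k : ℝ) + 1) * t))
      (fun _ k => Real.sin (((k : ℝ) + 1) * t))).hasGaussianLaw_eval ()
  have h0 : ∫ ω, trigPoly a b n ω t ∂P = 0 := by
    rw [trigPoly_eq_linForm]
    exact integral_linForm ha hb n _ _
  have hvar : Var[fun ω => trigPoly a b n ω t; P] = trigVar ρ n t := by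
    rw [variance_eq_sub hf.memLp_two, h0, ← integral_trigPoly_sq ha hb hab]
    simp [sq]
  have hlaw := hf.map_eq_gaussianReal
  rw [h0, hvar] at hlaw
  have hne : (trigVar ρ n t).toNNReal ≠ 0 := by simpa using hV
  have := nullSingletonClass_gaussianReal (μ := 0) hne
  have h1 : ∀ᵐ y ∂(P.map fun ω => trigPoly a b n ω t), y ≠ 0 := by
    rw [hlaw]
    exact compl_mem_ae_iff.2 (measure_singleton 0)
  exact ae_of_ae_map hf.aemeasurable h1

/-- The Kac-Rice density of the zeros of `f_n`, after regression on the first coefficient. -/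
theorem lintegral_kacRice_density (ha : IsStandardStationaryGaussian P ρ a)
    (hb : IsStandardStationaryGaussian P ρ b)
    (hab : IndepFun (fun ω k => a k ω) (fun ω k => b k ω) P) {n : ℕ} (hn : 1 ≤ n) {t : ℝ}
    (hu : trigRegr ρ n t ≠ 0) :
    ∫⁻ ω, gaussianPDF 0 1 (a 0 ω - trigPoly a b n ω t / trigRegr ρ n t) *
      ENNReal.ofReal |(trigPoly a b n ω t * trigRegrDeriv ρ n t -
        trigPolyDeriv a b n ω t * trigRegr ρ n t) / trigRegr ρ n t ^ 2| ∂P =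
      ENNReal.ofReal (1 / Real.pi * √(trigVar ρ n t * trigDerivVar ρ n t - trigCov ρ n t ^ 2) /
        trigVar ρ n t) := by
  have hG := IsGaussianProcess.sumElim_of_indepFun ha.gaussian hb.gaussian hab
  have hP := ha.gaussian.isProbabilityMeasure
  have hA2 : MemLp (a 0) 2 P := ha.memLp 0
  have hF2 : MemLp (fun ω => trigPoly a b n ω t) 2 P := by
    rw [trigPoly_eq_linForm]; exact memLp_linForm ha hb n _ _
  have hF'2 : MemLp (fun ω => trigPolyDeriv a b n ω t) 2 P := by
    rw [trigPolyDeriv_eq_linForm]; exact memLp_linForm ha hb n _ _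
  have iF := hF2.integrable (by norm_num)
  have iF' := hF'2.integrable (by norm_num)
  have iA := hA2.integrable (by norm_num)
  have hmul : ∀ {X Y : Ω → ℝ}, MemLp X 2 P → MemLp Y 2 P → Integrable (fun ω => X ω * Y ω) P :=
    fun hX hY => hX.integrable_mul hY
  have iAA := hmul hA2 hA2
  have iAF := hmul hA2 hF2
  have iAF' := hmul hA2 hF'2
  have iFF := hmul hF2 hF2
  have iFF' := hmul hF2 hF'2
  have iF'F' := hmul hF'2 hF'2
  have eA : ∫ ω, a 0 ω ∂P = 0 := ha.mean_zero 0
  have eF : ∫ ω, trigPoly a b n ω t ∂P = 0 := by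
    rw [trigPoly_eq_linForm]; exact integral_linForm ha hb n _ _
  have eF' : ∫ ω, trigPolyDeriv a b n ω t ∂P = 0 := by
    rw [trigPolyDeriv_eq_linForm]; exact integral_linForm ha hb n _ _
  have eAA : ∫ ω, a 0 ω * a 0 ω ∂P = 1 := by rw [ha.cov]; simp [ha.standard]
  have eAF := integral_coeff_mul_trigPoly ha hb hab hn t
  have eAF' := integral_coeff_mul_trigPolyDeriv ha hb hab hn t
  have eFF := integral_trigPoly_sq ha hb hab n t
  have eFF' := integral_trigPoly_mul_trigPolyDeriv ha hb hab n t
  have eF'F' := integral_trigPolyDeriv_sq ha hb hab n t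
  have hjoint : HasGaussianLaw (fun ω => (a 0 ω - trigPoly a b n ω t / trigRegr ρ n t,
      (trigPoly a b n ω t * trigRegrDeriv ρ n t -
        trigPolyDeriv a b n ω t * trigRegr ρ n t) / trigRegr ρ n t ^ 2)) P := by
    have h3 := (isGaussianProcess_linForm (S := Fin 3) hG n
      ![Pi.single 0 1, fun k => Real.cos (((k : ℝ) + 1) * t),
        fun k => -Real.sin (((k : ℝ) + 1) * t) * ((k : ℝ) + 1)]
      ![0, fun k => Real.sin (((k : ℝ) + 1) * t),
        fun k => Real.cos (((k : ℝ) + 1) * t) * ((k : ℝ) + 1)]).hasGaussianLaw Finset.univ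
    let p : Fin 3 → (({i // i ∈ (Finset.univ : Finset (Fin 3))} → ℝ) →L[ℝ] ℝ) := fun i =>
      ContinuousLinearMap.proj (R := ℝ) (φ := fun _ : {i // i ∈ (Finset.univ : Finset (Fin 3))} => ℝ)
        ⟨i, Finset.mem_univ i⟩
    have h4 := h3.map_fun ((p 0 - (trigRegr ρ n t)⁻¹ • p 1).prod
      ((trigRegr ρ n t ^ 2)⁻¹ • (trigRegrDeriv ρ n t • p 1 - trigRegr ρ n t • p 2)))
    refine h4.congr (Eventually.of_forall fun ω => ?_)
    have e0 : linForm a b n (Pi.single 0 1) 0 ω = a 0 ω := congrFun (linForm_single a b hn) ω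
    have e1 := congrFun (trigPoly_eq_linForm a b n t) ω
    have e2 := congrFun (trigPolyDeriv_eq_linForm a b n t) ω
    simp only [p, ContinuousLinearMap.prod_apply, sub_apply,
      smul_apply, ContinuousLinearMap.proj_apply, Finset.restrict,
      Matrix.cons_val_zero, Matrix.cons_val_one, Matrix.cons_val, smul_eq_mul, e0, ← e1, ← e2]
    apply Prod.ext <;> simp only [] <;> ring
  set F : Ω → ℝ := fun ω => trigPoly a b n ω t with hF
  set F' : Ω → ℝ := fun ω => trigPolyDeriv a b n ω t with hF'
  set u := trigRegr ρ n t
  set u' := trigRegrDeriv ρ n t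
  set V := trigVar ρ n t
  set C := trigCov ρ n t
  set D := trigDerivVar ρ n t
  have mX : ∫ ω, (a 0 ω - F ω / u) ∂P = 0 := by
    rw [integral_sub iA (iF.div_const _), integral_div, eA, eF]
    simp
  have mY : ∫ ω, (F ω * u' - F' ω * u) / u ^ 2 ∂P = 0 := by
    rw [integral_div, integral_sub (iF.mul_const _) (iF'.mul_const _), integral_mul_const,
      integral_mul_const, eF, eF']
    simp
  -- X = a_0 - F/u is independent of a_0. Adding the variance 1 of the level therefore restores the
  -- variance of F/u.
  have vXX : 1 + ∫ ω, (a 0 ω - F ω / u) ^ 2 ∂P = V / u ^ 2 := by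
    have j1 : Integrable (fun ω => a 0 ω * a 0 ω - 2 / u * (a 0 ω * F ω)) P :=
      iAA.sub (iAF.const_mul _)
    have j2 : Integrable (fun ω => 1 / u ^ 2 * (F ω * F ω)) P := iFF.const_mul _
    have : ∀ ω, (a 0 ω - F ω / u) ^ 2 =
        (a 0 ω * a 0 ω - 2 / u * (a 0 ω * F ω)) + 1 / u ^ 2 * (F ω * F ω) := by
      intro ω; field_simp; ring
    simp_rw [this]
    rw [integral_add j1 j2, integral_sub iAA (iAF.const_mul _), integral_const_mul,
      integral_const_mul, eAA, eAF, eFF]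
    field_simp
    ring
  have vXY : ∫ ω, (a 0 ω - F ω / u) * ((F ω * u' - F' ω * u) / u ^ 2) ∂P =
      (C * u - V * u') / u ^ 3 := by
    have j1 : Integrable (fun ω => u' / u ^ 2 * (a 0 ω * F ω) - 1 / u * (a 0 ω * F' ω)) P :=
      (iAF.const_mul _).sub (iAF'.const_mul _)
    have j2 : Integrable (fun ω => 1 / u ^ 2 * (F ω * F' ω) - u' / u ^ 3 * (F ω * F ω)) P :=
      (iFF'.const_mul _).sub (iFF.const_mul _)
    have : ∀ ω, (a 0 ω - F ω / u) * ((F ω * u' - F' ω * u) / u ^ 2) =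
        (u' / u ^ 2 * (a 0 ω * F ω) - 1 / u * (a 0 ω * F' ω)) +
        (1 / u ^ 2 * (F ω * F' ω) - u' / u ^ 3 * (F ω * F ω)) := by
      intro ω; field_simp; ring
    simp_rw [this]
    rw [integral_add j1 j2, integral_sub (iAF.const_mul _) (iAF'.const_mul _),
      integral_sub (iFF'.const_mul _) (iFF.const_mul _), integral_const_mul,
      integral_const_mul, integral_const_mul, integral_const_mul, eAF, eAF', eFF, eFF']
    field_simp
    ring
  have vYY : ∫ ω, ((F ω * u' - F' ω * u) / u ^ 2) ^ 2 ∂P =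
      (V * u' ^ 2 - 2 * C * u * u' + D * u ^ 2) / u ^ 4 := by
    have j1 : Integrable (fun ω => u' ^ 2 / u ^ 4 * (F ω * F ω) -
      2 * u' / u ^ 3 * (F ω * F' ω)) P := (iFF.const_mul _).sub (iFF'.const_mul _)
    have j2 : Integrable (fun ω => 1 / u ^ 2 * (F' ω * F' ω)) P := iF'F'.const_mul _
    have : ∀ ω, ((F ω * u' - F' ω * u) / u ^ 2) ^ 2 =
        (u' ^ 2 / u ^ 4 * (F ω * F ω) - 2 * u' / u ^ 3 * (F ω * F' ω)) +
          1 / u ^ 2 * (F' ω * F' ω) := by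
      intro ω; field_simp; ring
    simp_rw [this]
    rw [integral_add j1 j2, integral_sub (iFF.const_mul _) (iFF'.const_mul _), integral_const_mul,
      integral_const_mul, integral_const_mul, eFF, eFF', eF'F']
    field_simp
  have hmain := lintegral_gaussianPDF_mul_abs hjoint mX mY
  rw [vXX, vXY, vYY] at hmain
  refine hmain.trans ?_
  congr 1
  -- The covariance determinant of (F/u, (F/u)') is that of (F, F') over u⁴, so u' disappears here
  -- and u in the final quotient.
  have e : V / u ^ 2 * ((V * u' ^ 2 - 2 * C * u * u' + D * u ^ 2) / u ^ 4) -
      ((C * u - V * u') / u ^ 3) ^ 2 = (V * D - C ^ 2) / (u ^ 2) ^ 2 := by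
    field_simp
    ring
  rw [e, Real.sqrt_div' _ (by positivity), Real.sqrt_sq (by positivity)]
  field_simp

/-- The Kac-Rice formula for the number of zeros of `f_n` in `[0, 2π]`. -/
theorem kacRice (ha : IsStandardStationaryGaussian P ρ a)
    (hb : IsStandardStationaryGaussian P ρ b)
    (hab : IndepFun (fun ω k => a k ω) (fun ω k => b k ω) P) {n : ℕ} (hn : 1 ≤ n)
    (hV : ∀ t, 0 < trigVar ρ n t) :
    AEMeasurable (numZeros a b n) P ∧ ∫⁻ ω, numZeros a b n ω ∂P =
      ∫⁻ t in Set.Ioo 0 (2 * Real.pi), ENNReal.ofReal (1 / Real.pi *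
        √(trigVar ρ n t * trigDerivVar ρ n t - trigCov ρ n t ^ 2) / trigVar ρ n t) := by
  have hP := ha.gaussian.isProbabilityMeasure
  set s : Set ℝ := Set.Ioo 0 (2 * Real.pi) ∩ {t | trigRegr ρ n t ≠ 0} with hs
  have hso : IsOpen s := isOpen_Ioo.inter (isOpen_ne_fun (continuous_trigRegr ρ n) continuous_const)
  have hcz := countable_zeros_trigRegr ha.standard hn
  -- Besides the zeros of u, the closed interval loses its two endpoints.
  have hdiff : (Set.Icc 0 (2 * Real.pi) \ s).Countable := by
    refine (hcz.union (Set.countable_singleton 0 |>.union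
      (Set.countable_singleton (2 * Real.pi)))).mono ?_
    rintro t ⟨⟨h1, h2⟩, h3⟩
    simp only [Set.mem_union, Set.mem_singleton_iff, Set.mem_ofPred_eq]
    by_contra! hcon
    exact h3 ⟨⟨lt_of_le_of_ne h1 (Ne.symm hcon.2.1), lt_of_le_of_ne h2 hcon.2.2⟩, hcon.1⟩
  have hae : ∀ᵐ ω ∂P, numZeros a b n ω =
      ({t | t ∈ s ∧ trigPoly a b n ω t = 0}.encard : ℝ≥0∞) := by
    have := (ae_ball_iff hdiff).2 fun t _ => trigPoly_ae_ne_zero ha hb hab (hV t)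
    filter_upwards [this] with ω hω
    have : {t | t ∈ Set.Icc 0 (2 * Real.pi) ∧ trigPoly a b n ω t = 0} =
        {t | t ∈ s ∧ trigPoly a b n ω t = 0} := by
      ext t
      simp only [Set.mem_ofPred_eq]
      constructor
      · rintro ⟨h1, h2⟩
        refine ⟨?_, h2⟩
        by_contra h3
        exact hω t ⟨h1, h3⟩ h2
      · rintro ⟨h1, h2⟩
        exact ⟨Set.Ioo_subset_Icc_self h1.1, h2⟩
    rw [numZeros, this]
  have hmeas : Measurable fun ω => ({t | t ∈ s ∧ trigPoly a b n ω t = 0}.encard : ℝ≥0∞) := by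
    refine measurable_encard_zeros hso (fun t => ?_)
      fun ω => (continuous_trigPoly a b n ω).continuousOn
    have h1 := ha.measurable
    have h2 := hb.measurable
    unfold trigPoly
    fun_prop
  refine ⟨⟨_, hmeas, hae⟩, ?_⟩
  -- With the coordinate maps as coefficients, `trigPoly α β` is a deterministic function of the
  -- residual vector `r`, and h = -g/u.
  set α : ℕ → (ℕ ⊕ ℕ → ℝ) → ℝ := fun k e => e (Sum.inl k) with hα
  set β : ℕ → (ℕ ⊕ ℕ → ℝ) → ℝ := fun k e => e (Sum.inr k) with hβ
  set r : Ω → (ℕ ⊕ ℕ → ℝ) := fun ω i =>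
    Sum.elim (fun k => a k ω - ρ k * a 0 ω) (fun k => b k ω) i with hr
  set h : (ℕ ⊕ ℕ → ℝ) → ℝ → ℝ := fun e t => -(trigPoly α β n e t / trigRegr ρ n t) with hh
  set h' : (ℕ ⊕ ℕ → ℝ) → ℝ → ℝ := fun e t =>
    -((trigPolyDeriv α β n e t * trigRegr ρ n t - trigPoly α β n e t * trigRegrDeriv ρ n t) /
      trigRegr ρ n t ^ 2) with hh'
  have hfr : ∀ ω t, trigPoly α β n (r ω) t = trigPoly a b n ω t - a 0 ω * trigRegr ρ n t := by
    intro ω t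
    simp only [trigPoly, trigRegr, hα, hβ, hr, Sum.elim_inl, Sum.elim_inr, Finset.mul_sum,
      ← Finset.sum_sub_distrib]
    exact Finset.sum_congr rfl fun k _ => by ring
  have hfr' : ∀ ω t, trigPolyDeriv α β n (r ω) t =
      trigPolyDeriv a b n ω t - a 0 ω * trigRegrDeriv ρ n t := by
    intro ω t
    simp only [trigPolyDeriv, trigRegrDeriv, hα, hβ, hr, Sum.elim_inl, Sum.elim_inr,
      Finset.mul_sum, ← Finset.sum_sub_distrib]
    exact Finset.sum_congr rfl fun k _ => by ring
  have hhr : ∀ t, trigRegr ρ n t ≠ 0 → ∀ ω,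
      h (r ω) t = a 0 ω - trigPoly a b n ω t / trigRegr ρ n t := by
    intro t ht ω
    simp only [hh, hfr]
    field_simp
    ring
  have hhr' : ∀ t, trigRegr ρ n t ≠ 0 → ∀ ω, h' (r ω) t =
      (trigPoly a b n ω t * trigRegrDeriv ρ n t - trigPolyDeriv a b n ω t * trigRegr ρ n t) /
        trigRegr ρ n t ^ 2 := by
    intro t ht ω
    simp only [hh', hfr, hfr']
    field_simp
    ring
  have hrm : Measurable r := by
    rw [measurable_pi_iff]
    have h1 := ha.measurable
    have h2 := hb.measurable
    rintro (k | k)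
    · simp only [hr, Sum.elim_inl]; fun_prop
    · simp only [hr, Sum.elim_inr]; fun_prop
  have hlaw : P.map (a 0) = gaussianReal 0 1 := by
    have hg := ha.gaussian.hasGaussianLaw_eval 0
    rw [hg.map_eq_gaussianReal, ha.mean_zero 0, variance_eq_sub hg.memLp_two, ha.mean_zero 0]
    have : ∫ ω, (a 0 ^ 2) ω ∂P = 1 := by
      have := ha.cov 0 0
      simpa [sq, ha.standard] using this
    rw [this]
    simp
  have hind : IndepFun (a 0) r P := by
    have hG := IsGaussianProcess.sumElim_of_indepFun ha.gaussian hb.gaussian hab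
    have hjoint : IsGaussianProcess (Sum.elim (fun _ : Unit => a 0) (fun i ω => r ω i)) P := by
      have := IsGaussianProcess.sum_mul hG
        (S := Unit ⊕ (ℕ ⊕ ℕ))
        -- Each residual involves at most its own coefficient and a_0. For the index of a_0 the pair
        -- collapses and the coefficient is 1 - ρ(0) = 0.
        (Sum.elim (fun _ => {Sum.inl 0}) (fun i => {i, Sum.inl 0}))
        (Sum.elim (fun _ => Sum.elim 1 1) (Sum.elim
          (fun k => Sum.elim (fun l => (if l = k then 1 else 0) - (if l = 0 then ρ k else 0)) 0)
          (fun k => Sum.elim 0 (fun _ => 1))))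
      convert this using 2 with i
      funext ω
      rcases i with _ | k | k
      · simp
      · by_cases hk : k = 0
        · subst hk
          simp [hr, ha.standard]
        · rw [Sum.elim_inr, Sum.elim_inr, Sum.elim_inr, Finset.sum_pair (by simpa using hk)]
          simp [hr, hk, Ne.symm hk]
          ring
      · rw [Sum.elim_inr, Sum.elim_inr, Sum.elim_inr, Finset.sum_pair (by simp)]
        simp [hr]
    have := hjoint.indepFun_of_covariance_eq_zero (fun _ => (ha.measurable 0).aemeasurable)
      (fun i => ((measurable_pi_apply i).comp hrm).aemeasurable) ?_
    · exact this.comp (φ := fun x : Unit → ℝ => x ()) (ψ := id) (measurable_pi_apply ())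
        measurable_id
    · rintro _ (k | k)
      · have iA := ha.memLp 0
        simp only [hr, Sum.elim_inl]
        have iR : MemLp (fun ω => a k ω - ρ k * a 0 ω) 2 P := (ha.memLp k).sub (iA.const_mul _)
        have i1 : Integrable (fun ω => a k ω * a 0 ω) P := (ha.memLp k).integrable_mul iA
        have i2 : Integrable (fun ω => a 0 ω * a 0 ω) P := iA.integrable_mul iA
        rw [covariance_eq_sub iA iR, ha.mean_zero 0, zero_mul,
          sub_zero]
        have e : ∀ ω, (a 0 * fun ω => a k ω - ρ k * a 0 ω) ω =
            a k ω * a 0 ω - ρ k * (a 0 ω * a 0 ω) := by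
          intro ω; simp only [Pi.mul_apply]; ring
        simp_rw [e]
        rw [integral_sub i1 (i2.const_mul _), integral_const_mul, ha.cov, ha.cov]
        simp [ha.standard]
      · simp only [hr, Sum.elim_inr]
        rw [covariance_eq_sub (ha.memLp 0) (hb.memLp k), ha.mean_zero 0, zero_mul, sub_zero]
        exact integral_mul_eq_zero_of_indepFun ha hb hab 0 k
  have hαm : ∀ k, Measurable (α k) := fun k => measurable_pi_apply _
  have hβm : ∀ k, Measurable (β k) := fun k => measurable_pi_apply _
  have hu := continuous_trigRegr ρ n
  have hu' := continuous_trigRegrDeriv ρ n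
  have mQ : Measurable fun p : (ℕ ⊕ ℕ → ℝ) × ℝ => trigPoly α β n p.1 p.2 := by
    unfold trigPoly
    fun_prop
  have mQ' : Measurable fun p : (ℕ ⊕ ℕ → ℝ) × ℝ => trigPolyDeriv α β n p.1 p.2 := by
    unfold trigPolyDeriv
    fun_prop
  have mu : Measurable fun p : (ℕ ⊕ ℕ → ℝ) × ℝ => trigRegr ρ n p.2 :=
    hu.measurable.comp measurable_snd
  have mu' : Measurable fun p : (ℕ ⊕ ℕ → ℝ) × ℝ => trigRegrDeriv ρ n p.2 :=
    hu'.measurable.comp measurable_snd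
  have key := lintegral_encard_crossings (P := P) (ha.measurable 0) hrm hlaw hind (h := h)
    (h' := h') hso (mQ.div mu).neg (((mQ'.mul mu).sub (mQ.mul mu')).div (mu.pow_const 2)).neg
    (fun e t ht => ((hasDerivAt_trigPoly α β n e t).div (hasDerivAt_trigRegr ρ n t) ht.2).neg)
    (fun e => ContinuousOn.neg (ContinuousOn.div
      (((continuous_trigPolyDeriv α β n e).mul hu).sub
        ((continuous_trigPoly α β n e).mul hu')).continuousOn
      (hu.pow 2).continuousOn fun t ht => pow_ne_zero 2 ht.2))
  have hcross : ∀ ω, {t | t ∈ s ∧ h (r ω) t = a 0 ω} = {t | t ∈ s ∧ trigPoly a b n ω t = 0} := by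
    intro ω
    ext t
    simp only [Set.mem_ofPred_eq]
    refine and_congr_right fun ht => ?_
    rw [hhr t ht.2, sub_eq_self, div_eq_zero_iff]
    exact or_iff_left ht.2
  simp_rw [hcross] at key
  rw [lintegral_congr_ae hae, key]
  have hsI : s =ᵐ[volume] Set.Ioo 0 (2 * Real.pi) := by
    have : ∀ᵐ t ∂(volume : Measure ℝ), trigRegr ρ n t ≠ 0 :=
      compl_mem_ae_iff.2 (hcz.measure_zero volume)
    filter_upwards [this] with t ht
    apply propext
    exact ⟨fun h => h.1, fun h => ⟨h, ht⟩⟩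
  rw [← setLIntegral_congr hsI]
  refine setLIntegral_congr_fun hso.measurableSet fun t ht => ?_
  simp only [hhr t ht.2, hhr' t ht.2]
  exact lintegral_kacRice_density ha hb hab hn ht.2

end KacRice

/-! ### Spectral partial sums and the limits of V/n and D/n³. -/

section PartialSums

/-- The symmetric partial sums of the spectral series, in real form. -/
noncomputable def spectralSum (ρ : ℕ → ℝ) (n : ℕ) (t : ℝ) : ℝ :=
  ∑ j ∈ Finset.Icc (-(n : ℤ)) (n : ℤ), ρ j.natAbs * Real.cos ((j : ℝ) * t)

theorem IsSpectralFunction.tendsto_spectralSum {ρ : ℕ → ℝ} {ψ : ℝ → ℝ}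
    (h : IsSpectralFunction ρ ψ) {t : ℝ} (ht : t ∈ Set.Ioo 0 (2 * Real.pi)) :
    Tendsto (fun n => spectralSum ρ n t) atTop (𝓝 (ψ t)) := by
  have := (Complex.continuous_re.tendsto _).comp (h t ht)
  rw [Complex.ofReal_re] at this
  refine this.congr fun N => ?_
  simp only [Function.comp_apply, Complex.re_sum, spectralSum]
  refine Finset.sum_congr rfl fun k _ => ?_
  have e : Complex.I * (k : ℂ) * (t : ℂ) = (((k : ℝ) * t : ℝ) : ℂ) * Complex.I := by
    push_cast; ring
  rw [Complex.re_ofReal_mul, e, Complex.exp_ofReal_mul_I_re]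

theorem spectralSum_eq (ρ : ℕ → ℝ) (n : ℕ) (t : ℝ) :
    spectralSum ρ n t = ρ 0 + 2 * ∑ k ∈ Finset.range n, ρ (k + 1) * Real.cos (((k : ℝ) + 1) * t) := by
  induction n with
  | zero => simp [spectralSum]
  | succ n ih =>
    have h : Finset.Icc (-((n + 1 : ℕ) : ℤ)) ((n + 1 : ℕ) : ℤ) =
        insert (-((n : ℤ) + 1)) (insert ((n : ℤ) + 1) (Finset.Icc (-(n : ℤ)) (n : ℤ))) := by
      ext j
      simp only [Finset.mem_Icc, Finset.mem_insert]
      push_cast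
      omega
    have e1 : (-((n : ℤ) + 1)).natAbs = n + 1 := by omega
    have e2 : ((n : ℤ) + 1).natAbs = n + 1 := by omega
    rw [Finset.sum_range_succ, spectralSum, h, Finset.sum_insert (by simp; omega),
      Finset.sum_insert (by simp), ← spectralSum, ih, e1, e2]
    push_cast
    rw [show -((n : ℝ) + 1) * t = -(((n : ℝ) + 1) * t) by ring, Real.cos_neg]
    ring

theorem continuous_spectralSum (ρ : ℕ → ℝ) (n : ℕ) : Continuous (spectralSum ρ n) := by
  unfold spectralSum
  fun_prop

theorem sum_sum_range_succ_of_symm {f : ℕ → ℕ → ℝ} (hf : ∀ k l, f k l = f l k) (n : ℕ) :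
    ∑ k ∈ Finset.range (n + 1), ∑ l ∈ Finset.range (n + 1), f k l =
      ∑ k ∈ Finset.range n, ∑ l ∈ Finset.range n, f k l + f n n +
        2 * ∑ k ∈ Finset.range n, f n k := by
  rw [Finset.sum_range_succ, Finset.sum_range_succ]
  simp_rw [Finset.sum_range_succ (fun l => f _ l) n]
  rw [Finset.sum_add_distrib]
  simp_rw [fun k => hf k n]
  ring

/-- The last row and column, read away from the diagonal, contribute ρ(0) and twice each frequency
1, ..., n. Hence V/n is the Fejér mean of the spectral series. -/
theorem trigVar_succ {ρ : ℕ → ℝ} (n : ℕ) (t : ℝ) :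
    trigVar ρ (n + 1) t = trigVar ρ n t + spectralSum ρ n t := by
  rw [trigVar, sum_sum_range_succ_of_symm, ← trigVar, spectralSum_eq, ← Finset.sum_range_reflect]
  · simp only [sub_self, Int.natAbs_zero, zero_mul, Real.cos_zero, mul_one, add_assoc]
    congr 3
    refine Finset.sum_congr rfl fun k hk => ?_
    have hk' := Finset.mem_range.1 hk
    have e : ((n : ℤ) - ((n - 1 - k : ℕ) : ℤ)).natAbs = k + 1 := by omega
    have e' : ((n - 1 - k : ℕ) : ℝ) = n - 1 - k := by
      rw [Nat.cast_sub (by omega), Nat.cast_sub (by omega)]; simp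
    rw [e, e']
    ring_nf
  · intro k l
    rw [← Real.cos_neg, ← Int.natAbs_neg]
    ring_nf

theorem trigVar_eq_sum (ρ : ℕ → ℝ) (n : ℕ) (t : ℝ) :
    trigVar ρ n t = ∑ m ∈ Finset.range n, spectralSum ρ m t := by
  induction n with
  | zero => simp [trigVar]
  | succ n ih => rw [trigVar_succ, ih, Finset.sum_range_succ]

theorem trigVar_succ_eq_sum_mul (ρ : ℕ → ℝ) (n : ℕ) (t : ℝ) :
    trigVar ρ (n + 1) t = ((n : ℝ) + 1) * ρ 0 +
      2 * ∑ k ∈ Finset.range n, ((n : ℝ) - k) * (ρ (k + 1) * Real.cos (((k : ℝ) + 1) * t)) := by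
  induction n with
  | zero => simp [trigVar]
  | succ n ih =>
    rw [trigVar_succ, ih, spectralSum_eq, Finset.sum_range_succ, Finset.sum_range_succ]
    have : ∀ c : ℕ → ℝ, ∑ k ∈ Finset.range n, (((n + 1 : ℕ) : ℝ) - k) * c k =
        ∑ k ∈ Finset.range n, ((n : ℝ) - k) * c k + ∑ k ∈ Finset.range n, c k := by
      intro c
      rw [← Finset.sum_add_distrib]
      refine Finset.sum_congr rfl fun k _ => ?_
      push_cast
      ring
    rw [this]
    push_cast
    ring

/-- The last row and column carry the common factor n + 1; the remaining weights n - k at frequency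
k + 1 are exactly those of V_{n+1}. -/
theorem trigDerivVar_succ (ρ : ℕ → ℝ) (n : ℕ) (t : ℝ) :
    trigDerivVar ρ (n + 1) t = trigDerivVar ρ n t + ((n : ℝ) + 1) * trigVar ρ (n + 1) t := by
  rw [trigDerivVar, sum_sum_range_succ_of_symm, ← trigDerivVar, trigVar_succ_eq_sum_mul,
    ← Finset.sum_range_reflect]
  · simp only [sub_self, Int.natAbs_zero, zero_mul, Real.cos_zero, mul_one]
    have : ∑ j ∈ Finset.range n, ((n : ℝ) + 1) * (((n - 1 - j : ℕ) : ℝ) + 1) *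
        ρ ((n : ℤ) - ((n - 1 - j : ℕ) : ℤ)).natAbs * Real.cos ((n - ((n - 1 - j : ℕ) : ℝ)) * t) =
        ((n : ℝ) + 1) * ∑ k ∈ Finset.range n,
          ((n : ℝ) - k) * (ρ (k + 1) * Real.cos (((k : ℝ) + 1) * t)) := by
      rw [Finset.mul_sum]
      refine Finset.sum_congr rfl fun k hk => ?_
      have hk' := Finset.mem_range.1 hk
      have e : ((n : ℤ) - ((n - 1 - k : ℕ) : ℤ)).natAbs = k + 1 := by omega
      have e' : ((n - 1 - k : ℕ) : ℝ) = n - 1 - k := by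
        rw [Nat.cast_sub (by omega), Nat.cast_sub (by omega)]; simp
      rw [e, e']
      ring_nf
    rw [this]
    ring
  · intro k l
    rw [← Real.cos_neg, ← Int.natAbs_neg]
    ring_nf

theorem trigDerivVar_eq_sum (ρ : ℕ → ℝ) (n : ℕ) (t : ℝ) :
    trigDerivVar ρ n t = ∑ m ∈ Finset.range n, ((m : ℝ) + 1) * trigVar ρ (m + 1) t := by
  induction n with
  | zero => simp [trigDerivVar]
  | succ n ih => rw [trigDerivVar_succ, ih, Finset.sum_range_succ]

variable {ρ : ℕ → ℝ} {t c : ℝ}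

theorem tendsto_trigVar_div (h : Tendsto (fun n => spectralSum ρ n t) atTop (𝓝 c)) :
    Tendsto (fun n : ℕ => trigVar ρ n t / n) atTop (𝓝 c) := by
  refine h.cesaro.congr fun n => ?_
  rw [trigVar_eq_sum]
  ring

theorem sum_range_succ_sq (n : ℕ) :
    ∑ m ∈ Finset.range n, ((m : ℝ) + 1) ^ 2 = (n : ℝ) * (n + 1) * (2 * n + 1) / 6 := by
  induction n with
  | zero => simp
  | succ n ih => rw [Finset.sum_range_succ, ih]; push_cast; ring

theorem tendsto_sum_range_succ_sq_div :
    Tendsto (fun n : ℕ => (∑ m ∈ Finset.range n, ((m : ℝ) + 1) ^ 2) / (n : ℝ) ^ 3) atTop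
      (𝓝 (1 / 3)) := by
  have h1 : Tendsto (fun n : ℕ => (1 : ℝ) / n) atTop (𝓝 0) := tendsto_one_div_atTop_nhds_zero_nat
  have h2 : Tendsto (fun n : ℕ => (1 + (1 : ℝ) / n) * (2 + 1 / n) / 6) atTop
      (𝓝 ((1 + 0) * (2 + 0) / 6)) :=
    (((tendsto_const_nhds.add h1).mul (tendsto_const_nhds.add h1)).div_const 6)
  rw [show ((1 : ℝ) + 0) * (2 + 0) / 6 = 1 / 3 by norm_num] at h2
  refine h2.congr' ?_
  filter_upwards [eventually_gt_atTop 0] with n hn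
  have : (n : ℝ) ≠ 0 := by positivity
  rw [sum_range_succ_sq]
  field_simp

theorem tendsto_trigDerivVar_div (h : Tendsto (fun n => spectralSum ρ n t) atTop (𝓝 c)) :
    Tendsto (fun n : ℕ => trigDerivVar ρ n t / (n : ℝ) ^ 3) atTop (𝓝 (c / 3)) := by
  have h1 := (tendsto_trigVar_div h).comp (tendsto_add_atTop_nat 1)
  -- A weighted Cesàro argument: each summand of D is c (m + 1)² up to a smaller order, and the
  -- squares sum to about n³/3.
  have h2 : (fun m : ℕ => ((m : ℝ) + 1) * trigVar ρ (m + 1) t - c * ((m : ℝ) + 1) ^ 2) =o[atTop]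
      fun m : ℕ => ((m : ℝ) + 1) ^ 2 := by
    rw [isLittleO_iff_tendsto' (Eventually.of_forall fun m hm => by
      exfalso; exact absurd hm (by positivity))]
    have h3 := h1.sub_const c
    rw [sub_self] at h3
    refine h3.congr fun m => ?_
    have : (m : ℝ) + 1 ≠ 0 := by positivity
    simp only [Function.comp_apply]
    push_cast
    field_simp
  have hdiv : Tendsto (fun n : ℕ => ∑ m ∈ Finset.range n, ((m : ℝ) + 1) ^ 2) atTop atTop := by
    refine tendsto_atTop_mono (fun n => ?_) tendsto_natCast_atTop_atTop
    calc (n : ℝ) = ∑ m ∈ Finset.range n, (1 : ℝ) := by simp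
      _ ≤ _ := Finset.sum_le_sum fun m _ => one_le_pow₀ (by simp)
  have h4 := h2.sum_range (fun m => by positivity) hdiv
  have h5 := h4.tendsto_div_nhds_zero
  have h6 := (h5.add_const c).mul tendsto_sum_range_succ_sq_div
  rw [zero_add, ← div_eq_mul_one_div] at h6
  refine h6.congr' ?_
  filter_upwards [eventually_gt_atTop 0] with n hn
  have hpos : 0 < ∑ m ∈ Finset.range n, ((m : ℝ) + 1) ^ 2 :=
    Finset.sum_pos (fun m _ => by positivity) ⟨0, Finset.mem_range.2 hn⟩
  rw [Finset.sum_sub_distrib, ← Finset.mul_sum, ← trigDerivVar_eq_sum]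
  have := hpos.ne'
  field_simp
  ring

end PartialSums

/-! ### The kernel of the quadratic form of (f_n, f_n'). -/

section Kernel

/-- The nonnegative trigonometric polynomial `|∑_{k < n} (x + i y (k + 1)) e^{ikφ}|²`. -/
noncomputable def trigKernel (n : ℕ) (x y φ : ℝ) : ℝ :=
  (∑ k ∈ Finset.range n, (x * Real.cos (k * φ) - y * (k + 1) * Real.sin (k * φ))) ^ 2 +
    (∑ k ∈ Finset.range n, (x * Real.sin (k * φ) + y * (k + 1) * Real.cos (k * φ))) ^ 2

theorem trigKernel_nonneg (n : ℕ) (x y φ : ℝ) : 0 ≤ trigKernel n x y φ := by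
  unfold trigKernel
  positivity

theorem continuous_trigKernel (n : ℕ) (x y : ℝ) : Continuous (trigKernel n x y) := by
  unfold trigKernel
  fun_prop

theorem trigKernel_eq_sum (n : ℕ) (x y φ : ℝ) :
    trigKernel n x y φ = ∑ k ∈ Finset.range n, ∑ l ∈ Finset.range n,
      ((x ^ 2 + y ^ 2 * (k + 1) * (l + 1)) * Real.cos (((k : ℝ) - l) * φ) +
        2 * x * y * (l + 1) * Real.sin (((k : ℝ) - l) * φ)) := by
  -- Exchanging k and l turns the sine sum weighted by k + 1 into minus the one weighted by l + 1,
  -- so the two cross terms merge.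
  have hanti : ∑ k ∈ Finset.range n, ∑ l ∈ Finset.range n,
      ((k : ℝ) + 1) * Real.sin (((k : ℝ) - l) * φ) =
      -∑ k ∈ Finset.range n, ∑ l ∈ Finset.range n,
        ((l : ℝ) + 1) * Real.sin (((k : ℝ) - l) * φ) := by
    rw [Finset.sum_comm, ← Finset.sum_neg_distrib]
    refine Finset.sum_congr rfl fun l _ => ?_
    rw [← Finset.sum_neg_distrib]
    refine Finset.sum_congr rfl fun k _ => ?_
    rw [show ((k : ℝ) - l) * φ = -((l - k) * φ) by ring, Real.sin_neg]
    ring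
  have h1 : trigKernel n x y φ = ∑ k ∈ Finset.range n, ∑ l ∈ Finset.range n,
      (((x ^ 2 + y ^ 2 * (k + 1) * (l + 1)) * Real.cos (((k : ℝ) - l) * φ) +
        x * y * ((l + 1) * Real.sin (((k : ℝ) - l) * φ))) -
        x * y * ((k + 1) * Real.sin (((k : ℝ) - l) * φ))) := by
    rw [trigKernel, sq, sq, Finset.sum_mul_sum, Finset.sum_mul_sum, ← Finset.sum_add_distrib]
    refine Finset.sum_congr rfl fun k _ => ?_
    rw [← Finset.sum_add_distrib]
    refine Finset.sum_congr rfl fun l _ => ?_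
    rw [sub_mul (k : ℝ), Real.cos_sub, Real.sin_sub]
    ring
  have hpull : ∀ f : ℕ → ℕ → ℝ, ∑ k ∈ Finset.range n, ∑ l ∈ Finset.range n, x * y * f k l =
      x * y * ∑ k ∈ Finset.range n, ∑ l ∈ Finset.range n, f k l := by
    intro f
    simp only [Finset.mul_sum]
  rw [h1]
  simp_rw [Finset.sum_sub_distrib]
  rw [hpull, hanti, mul_neg, sub_neg_eq_add, ← hpull, ← Finset.sum_add_distrib]
  refine Finset.sum_congr rfl fun k _ => ?_
  rw [← Finset.sum_add_distrib]
  refine Finset.sum_congr rfl fun l _ => ?_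
  ring

open Complex in
/-- Away from the multiples of `2π` the kernel is of smaller order than its mean. -/
theorem trigKernel_mul_le (n : ℕ) (x y φ : ℝ) :
    (2 - 2 * Real.cos φ) * trigKernel n x y φ ≤ (2 * |x| + 2 * n * |y|) ^ 2 := by
  set z : ℂ := cexp (φ * I) with hz
  have hz1 : ‖z‖ = 1 := norm_exp_ofReal_mul_I φ
  have hzk : ∀ k : ℕ, z ^ k = (Real.cos (k * φ) : ℂ) + (Real.sin (k * φ) : ℂ) * I := by
    intro k
    rw [hz, ← Complex.exp_nat_mul, ← mul_assoc]
    rw [show (k : ℂ) * (φ : ℂ) = ((k * φ : ℝ) : ℂ) by push_cast; ring, exp_mul_I]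
    simp
  set w : ℂ := ∑ k ∈ Finset.range n, ((x : ℂ) + y * (k + 1) * I) * z ^ k with hw
  have hker : trigKernel n x y φ = ‖w‖ ^ 2 := by
    rw [← Complex.normSq_eq_norm_sq, Complex.normSq_apply, trigKernel, hw, Complex.re_sum,
      Complex.im_sum, sq, sq]
    have hterm : ∀ k : ℕ, ((x : ℂ) + y * (k + 1) * I) * z ^ k =
        ((x * Real.cos (k * φ) - y * (k + 1) * Real.sin (k * φ) : ℝ) : ℂ) +
          ((x * Real.sin (k * φ) + y * (k + 1) * Real.cos (k * φ) : ℝ) : ℂ) * I := by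
      intro k
      rw [hzk]
      push_cast
      linear_combination (y * (k + 1) * Complex.sin (k * φ)) * I_sq
    simp_rw [hterm]
    simp only [add_re, add_im, ofReal_re, ofReal_im, mul_re, mul_im, I_re, I_im, mul_zero,
      mul_one, zero_sub, neg_zero, add_zero, zero_add]
  have h1z : ‖1 - z‖ ^ 2 = 2 - 2 * Real.cos φ := by
    have := hzk 1
    rw [pow_one] at this
    rw [← Complex.normSq_eq_norm_sq, Complex.normSq_apply, this]
    simp only [sub_re, sub_im, one_re, one_im, add_re, add_im, ofReal_re, ofReal_im, mul_re, mul_im,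
      I_re, I_im, Nat.cast_one, one_mul]
    nlinarith [Real.sin_sq_add_cos_sq φ]
  -- Summation by parts gains one power of n: the right side is bounded by 2|x| + 2n|y| since |z| =
  -- 1.
  have hsum : (1 - z) * w = x * (1 - z ^ n) +
      y * I * (∑ k ∈ Finset.range n, z ^ k - n * z ^ n) := by
    rw [hw]
    clear hker hw w
    induction n with
    | zero => simp
    | succ n ih =>
      rw [Finset.sum_range_succ, mul_add, ih, Finset.sum_range_succ]
      push_cast
      ring
  have hbound : ‖(1 - z) * w‖ ≤ 2 * |x| + 2 * n * |y| := by
    have e1 : ‖1 - z ^ n‖ ≤ 2 := by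
      refine (norm_sub_le _ _).trans ?_
      rw [norm_pow, hz1]
      norm_num
    have e2 : ‖∑ k ∈ Finset.range n, z ^ k - n * z ^ n‖ ≤ 2 * n := by
      refine (norm_sub_le _ _).trans ?_
      have e3 : ‖∑ k ∈ Finset.range n, z ^ k‖ ≤ n := by
        refine (norm_sum_le _ _).trans ?_
        simp [norm_pow, hz1]
      have e4 : ‖(n : ℂ) * z ^ n‖ = n := by simp [hz1]
      rw [e4]
      linarith
    rw [hsum]
    refine (norm_add_le _ _).trans ?_
    rw [norm_mul, norm_mul, norm_mul, norm_I, norm_real, norm_real, Real.norm_eq_abs,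
      Real.norm_eq_abs, mul_one]
    have := mul_le_mul_of_nonneg_left e1 (abs_nonneg x)
    have := mul_le_mul_of_nonneg_left e2 (abs_nonneg y)
    linarith
  rw [hker, ← h1z, ← mul_pow, ← norm_mul]
  exact pow_le_pow_left₀ (norm_nonneg _) hbound 2

theorem integral_spectralSum_mul_cos (ρ : ℕ → ℝ) {M : ℕ} {m : ℤ} (hm : m.natAbs ≤ M) (c : ℝ) :
    ∫ θ in (0 : ℝ)..(2 * Real.pi), spectralSum ρ M θ * Real.cos ((m : ℝ) * θ + c) =
      2 * Real.pi * (ρ m.natAbs * Real.cos c) := by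
  simp only [spectralSum, Finset.sum_mul, mul_assoc]
  rw [intervalIntegral.integral_finsetSum
    (fun k _ => by apply Continuous.intervalIntegrable; fun_prop)]
  simp_rw [intervalIntegral.integral_const_mul, integral_cos_int_mul_cos, mul_add,
    Finset.sum_add_distrib]
  have h1 : m ∈ Finset.Icc (-(M : ℤ)) M := by rw [Finset.mem_Icc]; omega
  have h2 : -m ∈ Finset.Icc (-(M : ℤ)) M := by rw [Finset.mem_Icc]; omega
  rw [Finset.sum_eq_single_of_mem m h1 (fun b _ hb => by simp [hb]),
    Finset.sum_eq_single_of_mem (-m) h2 (fun b _ hb => by simp [hb])]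
  simp
  ring

/-- The right side is 2π E[(x f_n - y f_n')²] for the model with correlation ρ. The kernel has
frequencies |k - l| < n only, so every partial sum of order M ≥ n already integrates it exactly. -/
theorem integral_spectralSum_mul_trigKernel (ρ : ℕ → ℝ) {n M : ℕ} (hM : n ≤ M) (x y t : ℝ) :
    ∫ θ in (0 : ℝ)..(2 * Real.pi), spectralSum ρ M θ * trigKernel n x y (θ - t) =
      2 * Real.pi * (x ^ 2 * trigVar ρ n t - 2 * x * y * trigCov ρ n t +
        y ^ 2 * trigDerivVar ρ n t) := by
  have hS := continuous_spectralSum ρ M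
  have hcos : ∀ (k l : ℕ) (θ : ℝ), Real.cos (((k : ℝ) - l) * (θ - t)) =
      Real.cos ((((k : ℤ) - (l : ℤ) : ℤ) : ℝ) * θ + -(((k : ℝ) - l) * t)) := by
    intro k l θ
    push_cast
    ring_nf
  have hsin : ∀ (k l : ℕ) (θ : ℝ), Real.sin (((k : ℝ) - l) * (θ - t)) =
      Real.cos ((((k : ℤ) - (l : ℤ) : ℤ) : ℝ) * θ + -(((k : ℝ) - l) * t + Real.pi / 2)) := by
    intro k l θ
    rw [← Real.cos_sub_pi_div_two]
    push_cast
    ring_nf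
  have hterm : ∀ θ, spectralSum ρ M θ * trigKernel n x y (θ - t) =
      ∑ k ∈ Finset.range n, ∑ l ∈ Finset.range n,
      ((x ^ 2 + y ^ 2 * (k + 1) * (l + 1)) * (spectralSum ρ M θ *
          Real.cos ((((k : ℤ) - (l : ℤ) : ℤ) : ℝ) * θ + -(((k : ℝ) - l) * t))) +
        2 * x * y * (l + 1) * (spectralSum ρ M θ *
          Real.cos ((((k : ℤ) - (l : ℤ) : ℤ) : ℝ) * θ + -(((k : ℝ) - l) * t + Real.pi / 2)))) := by
    intro θ
    rw [trigKernel_eq_sum, Finset.mul_sum]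
    refine Finset.sum_congr rfl fun k _ => ?_
    rw [Finset.mul_sum]
    refine Finset.sum_congr rfl fun l _ => ?_
    rw [hcos, hsin]
    ring
  simp_rw [hterm]
  rw [intervalIntegral.integral_finsetSum
    (fun k _ => by apply Continuous.intervalIntegrable; fun_prop)]
  have hint : ∀ k ∈ Finset.range n, ∫ θ in (0 : ℝ)..(2 * Real.pi), ∑ l ∈ Finset.range n,
      ((x ^ 2 + y ^ 2 * (k + 1) * (l + 1)) * (spectralSum ρ M θ *
          Real.cos ((((k : ℤ) - (l : ℤ) : ℤ) : ℝ) * θ + -(((k : ℝ) - l) * t))) +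
        2 * x * y * (l + 1) * (spectralSum ρ M θ *
          Real.cos ((((k : ℤ) - (l : ℤ) : ℤ) : ℝ) * θ + -(((k : ℝ) - l) * t + Real.pi / 2)))) =
      ∑ l ∈ Finset.range n, 2 * Real.pi *
        (x ^ 2 * (ρ ((k : ℤ) - (l : ℤ)).natAbs * Real.cos (((k : ℝ) - l) * t)) -
        2 * x * y * (((l : ℝ) + 1) * ρ ((k : ℤ) - (l : ℤ)).natAbs * Real.sin (((k : ℝ) - l) * t)) +
        y ^ 2 * (((k : ℝ) + 1) * ((l : ℝ) + 1) * ρ ((k : ℤ) - (l : ℤ)).natAbs *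
          Real.cos (((k : ℝ) - l) * t))) := by
    intro k hk
    rw [intervalIntegral.integral_finsetSum
      (fun l _ => by apply Continuous.intervalIntegrable; fun_prop)]
    refine Finset.sum_congr rfl fun l hl => ?_
    have hk' := Finset.mem_range.1 hk
    have hl' := Finset.mem_range.1 hl
    have hm : ((k : ℤ) - (l : ℤ)).natAbs ≤ M := by omega
    rw [intervalIntegral.integral_add
      (by apply Continuous.intervalIntegrable; fun_prop)
      (by apply Continuous.intervalIntegrable; fun_prop), intervalIntegral.integral_const_mul,
      intervalIntegral.integral_const_mul, integral_spectralSum_mul_cos ρ hm,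
      integral_spectralSum_mul_cos ρ hm, Real.cos_neg, Real.cos_neg, Real.cos_add_pi_div_two]
    ring
  rw [Finset.sum_congr rfl hint]
  simp_rw [← Finset.mul_sum, Finset.sum_add_distrib, Finset.sum_sub_distrib, ← Finset.mul_sum]
  rfl

/-- The case of white noise, ρ = δ₀, whose spectral function is 1. -/
theorem integral_trigKernel (n : ℕ) (x y t : ℝ) :
    ∫ θ in (0 : ℝ)..(2 * Real.pi), trigKernel n x y (θ - t) =
      2 * Real.pi * (x ^ 2 * n + y ^ 2 * ∑ k ∈ Finset.range n, ((k : ℝ) + 1) ^ 2) := by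
  have h := integral_spectralSum_mul_trigKernel (Pi.single 0 1) (le_refl n) x y t
  have hδ : ∀ k l : ℕ, (Pi.single 0 1 : ℕ → ℝ) ((k : ℤ) - (l : ℤ)).natAbs =
      if l = k then 1 else 0 := by
    intro k l
    rw [Pi.single_apply]
    congr 1
    simp only [Int.natAbs_eq_zero, sub_eq_zero, Nat.cast_inj]
    exact propext eq_comm
  have h1 : ∀ θ, spectralSum (Pi.single 0 1) n θ = 1 := by
    intro θ
    simp [spectralSum_eq]
  have h2 : trigVar (Pi.single 0 1) n t = n := by
    simp only [trigVar, hδ, ite_mul, one_mul, zero_mul, Finset.sum_ite_eq']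
    rw [Finset.sum_congr rfl fun k hk => by rw [if_pos hk, sub_self, zero_mul, Real.cos_zero]]
    simp
  have h3 : trigCov (Pi.single 0 1) n t = 0 := by
    simp [trigCov, hδ]
  have h4 : trigDerivVar (Pi.single 0 1) n t = ∑ k ∈ Finset.range n, ((k : ℝ) + 1) ^ 2 := by
    simp only [trigDerivVar, hδ]
    simp only [mul_ite, mul_one, mul_zero, ite_mul, zero_mul, Finset.sum_ite_eq']
    refine Finset.sum_congr rfl fun k hk => ?_
    rw [if_pos hk, sub_self, zero_mul, Real.cos_zero]
    ring
  simp_rw [h1, one_mul, h2, h3, h4] at h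
  rw [h]
  ring

end Kernel

/-! ### Domination by the spectral measure and its consequences. -/

section Fatou

variable {ρ : ℕ → ℝ} {ψ : ℝ → ℝ}

/-- The spectral measure dominates the measure with density `ψ`. -/
theorem integral_le_of_le_mul_trigKernel (hψ : IsSpectralFunction ρ ψ)
    (hpos : ∀ n t, 0 ≤ trigVar ρ n t) {n : ℕ} {x y t : ℝ} {p : ℝ → ℝ} (hp : Continuous p)
    (hle : ∀ θ ∈ Set.Ioo 0 (2 * Real.pi), p θ ≤ ψ θ * trigKernel n x y (θ - t)) :
    ∫ θ in (0 : ℝ)..(2 * Real.pi), p θ ≤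
      2 * Real.pi * (x ^ 2 * trigVar ρ n t - 2 * x * y * trigCov ρ n t +
        y ^ 2 * trigDerivVar ρ n t) := by
  set Q : ℝ := 2 * Real.pi * (x ^ 2 * trigVar ρ n t - 2 * x * y * trigCov ρ n t +
        y ^ 2 * trigDerivVar ρ n t) with hQ
  have hpi : (0 : ℝ) ≤ 2 * Real.pi := by positivity
  have hg : Continuous fun θ => trigKernel n x y (θ - t) :=
    (continuous_trigKernel n x y).comp (continuous_id.sub continuous_const)
  -- The partial sums of the spectral series may change sign, but their Fejér means V_N/N are
  -- variances, hence nonnegative, as Fatou's lemma requires.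
  set G : ℕ → ℝ → ℝ := fun N θ => trigVar ρ N θ / N * trigKernel n x y (θ - t) with hG
  have hVc : ∀ N, Continuous (trigVar ρ N) := fun N => by unfold trigVar; fun_prop
  have hGc : ∀ N, Continuous (G N) := fun N => ((hVc N).div_const _).mul hg
  have hG0 : ∀ N θ, 0 ≤ G N θ := fun N θ =>
    mul_nonneg (div_nonneg (hpos N θ) (Nat.cast_nonneg N)) (trigKernel_nonneg _ _ _ _)
  have hGlim : ∀ θ ∈ Set.Ioo 0 (2 * Real.pi),
      Tendsto (fun N => G N θ) atTop (𝓝 (ψ θ * trigKernel n x y (θ - t))) := fun θ hθ =>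
    (tendsto_trigVar_div (hψ.tendsto_spectralSum hθ)).mul_const _
  -- The partial sums integrate the kernel to Q from order n on, so their Cesàro means tend to Q.
  have hInt : Tendsto (fun N : ℕ => ∫ θ in (0 : ℝ)..(2 * Real.pi), G N θ) atTop (𝓝 Q) := by
    have h1 : Tendsto (fun M : ℕ => ∫ θ in (0 : ℝ)..(2 * Real.pi),
        spectralSum ρ M θ * trigKernel n x y (θ - t)) atTop (𝓝 Q) := by
      refine tendsto_const_nhds.congr' ?_
      filter_upwards [eventually_ge_atTop n] with M hM
      rw [integral_spectralSum_mul_trigKernel ρ hM]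
    refine h1.cesaro.congr fun N => ?_
    have hSg : ∀ M, Continuous fun θ => spectralSum ρ M θ * trigKernel n x y (θ - t) := fun M =>
      (continuous_spectralSum ρ M).mul hg
    rw [← intervalIntegral.integral_finsetSum (fun M _ => (hSg M).intervalIntegrable _ _),
      ← intervalIntegral.integral_const_mul]
    refine intervalIntegral.integral_congr fun θ _ => ?_
    simp only [hG, trigVar_eq_sum, Finset.sum_div, Finset.sum_mul, Finset.mul_sum]
    refine Finset.sum_congr rfl fun m _ => by ring
  have hQ0 : 0 ≤ Q := ge_of_tendsto' hInt fun N =>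
    intervalIntegral.integral_nonneg hpi fun θ _ => hG0 N θ
  have hIoo : ∀ N, ∫ θ in (0 : ℝ)..(2 * Real.pi), G N θ =
      ∫ θ in Set.Ioo 0 (2 * Real.pi), G N θ := fun N => by
    rw [intervalIntegral.integral_of_le hpi, integral_Ioc_eq_integral_Ioo]
  have hfatou : ∫⁻ θ in Set.Ioo 0 (2 * Real.pi), ENNReal.ofReal (p θ) ≤ ENNReal.ofReal Q := by
    calc ∫⁻ θ in Set.Ioo 0 (2 * Real.pi), ENNReal.ofReal (p θ)
        ≤ ∫⁻ θ in Set.Ioo 0 (2 * Real.pi),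
            liminf (fun N => ENNReal.ofReal (G N θ)) atTop := by
          refine setLIntegral_mono' measurableSet_Ioo fun θ hθ => ?_
          have hl : Tendsto (fun N => ENNReal.ofReal (G N θ)) atTop
              (𝓝 (ENNReal.ofReal (ψ θ * trigKernel n x y (θ - t)))) :=
            (ENNReal.continuous_ofReal.tendsto _).comp (hGlim θ hθ)
          rw [hl.liminf_eq]
          exact ENNReal.ofReal_le_ofReal (hle θ hθ)
      _ ≤ liminf (fun N => ∫⁻ θ in Set.Ioo 0 (2 * Real.pi), ENNReal.ofReal (G N θ)) atTop :=
          lintegral_liminf_le fun N => (hGc N).measurable.ennreal_ofReal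
      _ = liminf (fun N => ENNReal.ofReal (∫ θ in (0 : ℝ)..(2 * Real.pi), G N θ)) atTop := by
          congr 1
          ext N
          rw [hIoo, ofReal_integral_eq_lintegral_ofReal]
          · exact (hGc N).integrableOn_Icc.mono_set Set.Ioo_subset_Icc_self
          · exact Eventually.of_forall fun θ => hG0 N θ
      _ = ENNReal.ofReal Q :=
          ((ENNReal.continuous_ofReal.tendsto _).comp hInt).liminf_eq
  rw [intervalIntegral.integral_of_le hpi, integral_Ioc_eq_integral_Ioo]
  have hpint : IntegrableOn p (Set.Ioo 0 (2 * Real.pi)) :=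
    hp.integrableOn_Icc.mono_set Set.Ioo_subset_Icc_self
  rw [integral_eq_lintegral_pos_part_sub_lintegral_neg_part hpint]
  have := ENNReal.toReal_mono ENNReal.ofReal_ne_top hfatou
  rw [ENNReal.toReal_ofReal hQ0] at this
  have h0 : 0 ≤ (∫⁻ θ in Set.Ioo 0 (2 * Real.pi), ENNReal.ofReal (-p θ)).toReal :=
    ENNReal.toReal_nonneg
  linarith

/-- The kernel with x = 1, y = 0 has integral 2πn, and ψ is at least γ. This makes f_n(t)
nondegenerate, uniformly in t. -/
theorem mul_le_trigVar (hψ : IsSpectralFunction ρ ψ) (hpos : ∀ n t, 0 ≤ trigVar ρ n t) {γ : ℝ}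
    (hγ : ∀ x ∈ Set.Ioo 0 (2 * Real.pi), γ ≤ ψ x) (n : ℕ) (t : ℝ) : γ * n ≤ trigVar ρ n t := by
  have h := integral_le_of_le_mul_trigKernel hψ hpos (n := n) (x := 1) (y := 0) (t := t)
    (p := fun θ => γ * trigKernel n 1 0 (θ - t))
    (((continuous_trigKernel n 1 0).comp (continuous_id.sub continuous_const)).const_mul γ)
    (fun θ hθ => mul_le_mul_of_nonneg_right (hγ θ hθ) (trigKernel_nonneg _ _ _ _))
  rw [intervalIntegral.integral_const_mul, integral_trigKernel] at h
  have hpi : (0 : ℝ) < 2 * Real.pi := by positivity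
  nlinarith

/-- The lower bound for n² V ∓ 2nC + D and the limit of n² V + D agree to leading order n³, which
leaves no room for C in either direction. -/
theorem tendsto_trigCov_div (hψ : IsSpectralFunction ρ ψ) (hpos : ∀ n t, 0 ≤ trigVar ρ n t)
    (hψ0 : ∀ x ∈ Set.Ioo 0 (2 * Real.pi), 0 < ψ x) {t : ℝ} (ht : t ∈ Set.Ioo 0 (2 * Real.pi))
    (hc : ContinuousAt ψ t) :
    Tendsto (fun n : ℕ => trigCov ρ n t / (n : ℝ) ^ 2) atTop (𝓝 0) := by
  have hSt := hψ.tendsto_spectralSum ht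
  have hV := tendsto_trigVar_div hSt
  have hD := tendsto_trigDerivVar_div hSt
  have key : ∀ ε > 0, ε < ψ t → ∀ s : ℝ, s ^ 2 = 1 →
      ∀ᶠ n : ℕ in atTop, s * (trigCov ρ n t / (n : ℝ) ^ 2) < ε := by
    intro ε hε hεψ s hs
    obtain ⟨δ₀, hδ₀, hδψ⟩ := Metric.continuousAt_iff.1 hc ε hε
    -- The last two terms keep θ - t at distance at least δ from ±2π, where the periodic kernel
    -- would peak again.
    set δ : ℝ := min δ₀ (min t (2 * Real.pi - t)) with hδdef
    have hδ : 0 < δ := lt_min hδ₀ (lt_min ht.1 (by linarith [ht.2]))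
    have hδt : δ ≤ t := (min_le_right _ _).trans (min_le_left _ _)
    have hδt' : δ ≤ 2 * Real.pi - t := (min_le_right _ _).trans (min_le_right _ _)
    have hδπ : δ ≤ Real.pi := by linarith
    set κ : ℝ := 2 - 2 * Real.cos δ with hκ
    have hκ0 : 0 < κ := by
      have : Real.cos δ < Real.cos 0 :=
        Real.cos_lt_cos_of_nonneg_of_le_pi le_rfl hδπ hδ
      rw [Real.cos_zero] at this
      linarith
    set m : ℝ := ψ t - ε with hm
    have hm0 : 0 < m := by linarith
    have hs1 : |s| = 1 := by
      rw [← sq_eq_sq₀ (abs_nonneg s) zero_le_one, sq_abs, hs, one_pow]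
    -- For x = n, |y| = 1 the kernel is at most (4n)²/κ outside the δ-neighbourhood of t.
    -- Subtracting this constant makes the minorant nonpositive there, so it is continuous and no
    -- cutoff is needed; the loss is O(n²) against a mass of order n³.
    have hbound : ∀ n : ℕ, m * ((2 * Real.pi) * ((n : ℝ) ^ 2 * n +
        ∑ k ∈ Finset.range n, ((k : ℝ) + 1) ^ 2) - 2 * Real.pi * (16 * (n : ℝ) ^ 2 / κ)) ≤
        2 * Real.pi * ((n : ℝ) ^ 2 * trigVar ρ n t - 2 * n * s * trigCov ρ n t +
          trigDerivVar ρ n t) := by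
      intro n
      have hk : Continuous fun θ => trigKernel n n s (θ - t) :=
        (continuous_trigKernel n n s).comp (continuous_id.sub continuous_const)
      have h := integral_le_of_le_mul_trigKernel hψ hpos (n := n) (x := n) (y := s) (t := t)
        (p := fun θ => m * (trigKernel n n s (θ - t) - 16 * (n : ℝ) ^ 2 / κ))
        ((hk.sub continuous_const).const_mul m) ?_
      · rw [intervalIntegral.integral_const_mul, intervalIntegral.integral_sub
          (hk.intervalIntegrable _ _) (continuous_const.intervalIntegrable _ _),
          integral_trigKernel, hs, intervalIntegral.integral_const, smul_eq_mul] at h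
        linarith
      · intro θ hθ
        have hk0 := trigKernel_nonneg n n s (θ - t)
        have hK0 : 0 ≤ 16 * (n : ℝ) ^ 2 / κ := by positivity
        by_cases hd : |θ - t| < δ
        · have h1 : dist (ψ θ) (ψ t) < ε :=
            hδψ (by rw [Real.dist_eq]; exact hd.trans_le (min_le_left _ _))
          rw [Real.dist_eq] at h1
          have h2 : m ≤ ψ θ := by linarith [(abs_lt.1 h1).1]
          have h3 := mul_le_mul_of_nonneg_right h2 hk0
          have h4 := mul_nonneg hm0.le hK0
          linarith
        · push Not at hd
          have h1 : Real.cos (θ - t) ≤ Real.cos δ := by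
            rw [← Real.cos_abs (θ - t)]
            have hub : |θ - t| ≤ 2 * Real.pi - δ := by
              rw [abs_le]
              constructor <;> linarith [hθ.1, hθ.2]
            rcases le_total |θ - t| Real.pi with h | h
            · exact Real.cos_le_cos_of_nonneg_of_le_pi hδ.le h hd
            · rw [← Real.cos_two_pi_sub]
              exact Real.cos_le_cos_of_nonneg_of_le_pi hδ.le (by linarith) (by linarith)
          have h2 := trigKernel_mul_le n n s (θ - t)
          rw [hs1, Nat.abs_cast] at h2
          have h3 : κ * trigKernel n n s (θ - t) ≤ 16 * (n : ℝ) ^ 2 := by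
            have : κ * trigKernel n n s (θ - t) ≤
                (2 - 2 * Real.cos (θ - t)) * trigKernel n n s (θ - t) :=
              mul_le_mul_of_nonneg_right (by linarith) hk0
            nlinarith
          have h4 : trigKernel n n s (θ - t) ≤ 16 * (n : ℝ) ^ 2 / κ := by
            rw [le_div_iff₀ hκ0]
            linarith
          have h5 := mul_nonneg (hψ0 θ hθ).le hk0
          have h6 : m * (trigKernel n n s (θ - t) - 16 * (n : ℝ) ^ 2 / κ) ≤ 0 :=
            mul_nonpos_of_nonneg_of_nonpos hm0.le (by linarith)
          linarith
    have h1 : Tendsto (fun n : ℕ => (1 : ℝ) / n) atTop (𝓝 0) := tendsto_one_div_atTop_nhds_zero_nat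
    have hlim : Tendsto (fun n : ℕ => (trigVar ρ n t / n + trigDerivVar ρ n t / (n : ℝ) ^ 3 -
        m * (1 + (∑ k ∈ Finset.range n, ((k : ℝ) + 1) ^ 2) / (n : ℝ) ^ 3 -
          16 / κ * (1 / n))) / 2) atTop (𝓝 ((ψ t + ψ t / 3 - m * (1 + 1 / 3 - 16 / κ * 0)) / 2)) :=
      ((hV.add hD).sub (((tendsto_const_nhds.add tendsto_sum_range_succ_sq_div).sub
        (h1.const_mul _)).const_mul m)).div_const 2
    -- With m = ψ(t) - ε the left side is 2ε/3.
    have hlt : (ψ t + ψ t / 3 - m * (1 + 1 / 3 - 16 / κ * 0)) / 2 < ε := by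
      rw [hm]
      linarith
    filter_upwards [hlim.eventually_lt_const hlt, eventually_gt_atTop 0] with n hn hn0
    refine lt_of_le_of_lt ?_ hn
    have hnpos : (0 : ℝ) < n := by exact_mod_cast hn0
    have h2 := hbound n
    have hpi : (0 : ℝ) < 2 * Real.pi := by positivity
    have h3 : m * ((n : ℝ) ^ 2 * n + ∑ k ∈ Finset.range n, ((k : ℝ) + 1) ^ 2 -
        16 * (n : ℝ) ^ 2 / κ) ≤ (n : ℝ) ^ 2 * trigVar ρ n t - 2 * n * s * trigCov ρ n t +
          trigDerivVar ρ n t := by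
      refine le_of_mul_le_mul_left ?_ hpi
      linarith
    have h4 := div_le_div_of_nonneg_right h3 (show (0 : ℝ) ≤ (n : ℝ) ^ 3 by positivity)
    have e1 : m * ((n : ℝ) ^ 2 * n + ∑ k ∈ Finset.range n, ((k : ℝ) + 1) ^ 2 -
        16 * (n : ℝ) ^ 2 / κ) / (n : ℝ) ^ 3 =
        m * (1 + (∑ k ∈ Finset.range n, ((k : ℝ) + 1) ^ 2) / (n : ℝ) ^ 3 - 16 / κ * (1 / n)) := by
      field_simp
    have e2 : ((n : ℝ) ^ 2 * trigVar ρ n t - 2 * n * s * trigCov ρ n t +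
          trigDerivVar ρ n t) / (n : ℝ) ^ 3 = trigVar ρ n t / n -
          2 * (s * (trigCov ρ n t / (n : ℝ) ^ 2)) + trigDerivVar ρ n t / (n : ℝ) ^ 3 := by
      field_simp
    rw [e1, e2] at h4
    linarith
  rw [Metric.tendsto_nhds]
  intro ε hε
  have hψt := hψ0 t ht
  have hε' : 0 < min ε (ψ t / 2) := lt_min hε (by linarith)
  -- The minimum with ψ(t)/2 keeps m = ψ(t) - ε positive.
  have hε'' : min ε (ψ t / 2) < ψ t := lt_of_le_of_lt (min_le_right _ _) (by linarith)
  filter_upwards [key _ hε' hε'' 1 (by norm_num), key _ hε' hε'' (-1) (by norm_num)] with n h1 h2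
  rw [Real.dist_eq, sub_zero, abs_lt]
  have := min_le_left ε (ψ t / 2)
  constructor <;> linarith

end Fatou

/-! ### Convergence of the integrated density of zeros. -/

section Limit

/-- On a finite measure space, a pointwise convergent sequence which is bounded in `L²` converges
in mean. -/
theorem tendsto_integral_of_tendsto_of_integral_sq_le {α : Type*} [MeasurableSpace α]
    {μ : Measure α} [IsFiniteMeasure μ] {u : ℕ → α → ℝ} {c K : ℝ} (hu : ∀ n, Integrable (u n) μ)
    (hu2 : ∀ n, Integrable (fun x => u n x ^ 2) μ) (hK : ∀ n, ∫ x, u n x ^ 2 ∂μ ≤ K)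
    (hlim : ∀ᵐ x ∂μ, Tendsto (fun n => u n x) atTop (𝓝 c)) :
    Tendsto (fun n => ∫ x, u n x ∂μ) atTop (𝓝 (∫ _, c ∂μ)) := by
  -- Truncation at M: dominated convergence below M, and above it |u - c| ≤ (u - c)²/M, which the L²
  -- bound makes small.
  have hmin : ∀ M : ℝ, 0 ≤ M →
      Tendsto (fun n => ∫ x, min |u n x - c| M ∂μ) atTop (𝓝 0) := by
    intro M hM
    have h0 : ∫ x, min |c - c| M ∂μ = 0 := by simp [hM]
    rw [← h0]
    refine tendsto_integral_of_dominated_convergence (fun _ => M) (fun n => ?_)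
      (integrable_const M) (fun n => Eventually.of_forall fun x => ?_) ?_
    · exact (((hu n).sub (integrable_const c)).abs.inf (integrable_const M)).aestronglyMeasurable
    · rw [Real.norm_eq_abs, abs_of_nonneg (le_min (abs_nonneg _) hM)]
      exact min_le_right _ _
    · filter_upwards [hlim] with x hx
      exact (hx.sub_const c).abs.min tendsto_const_nhds
  set B : ℝ := 2 * K + 2 * ∫ _, c ^ 2 ∂μ with hB
  have hB0 : 0 ≤ B := by
    have h1 : 0 ≤ K := (integral_nonneg fun x => sq_nonneg (u 0 x)).trans (hK 0)
    have h2 : 0 ≤ ∫ _, c ^ 2 ∂μ := integral_nonneg fun x => sq_nonneg c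
    positivity
  have hle : ∀ M : ℝ, 0 < M → ∀ n, |∫ x, u n x ∂μ - ∫ _, c ∂μ| ≤
      ∫ x, min |u n x - c| M ∂μ + B / M := by
    intro M hM n
    have hI1 : Integrable (fun x => min |u n x - c| M) μ :=
      ((hu n).sub (integrable_const c)).abs.inf (integrable_const M)
    have hI2 : Integrable (fun x => (2 * u n x ^ 2 + 2 * c ^ 2) / M) μ :=
      (((hu2 n).const_mul 2).add (integrable_const _)).div_const M
    have hIB : ∫ x, (2 * u n x ^ 2 + 2 * c ^ 2) / M ∂μ ≤ B / M := by
      rw [integral_div, integral_add ((hu2 n).const_mul 2) (integrable_const _), integral_const_mul,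
        integral_const_mul]
      have := hK n
      gcongr
      linarith
    rw [← integral_sub (hu n) (integrable_const c)]
    refine abs_integral_le_integral_abs.trans (le_trans ?_ (add_le_add le_rfl hIB))
    rw [← integral_add hI1 hI2]
    refine integral_mono ((hu n).sub (integrable_const c)).abs (hI1.add hI2) fun x => ?_
    change |u n x - c| ≤ min |u n x - c| M + (2 * u n x ^ 2 + 2 * c ^ 2) / M
    rcases le_total |u n x - c| M with h | h
    · rw [min_eq_left h]
      have : 0 ≤ (2 * u n x ^ 2 + 2 * c ^ 2) / M := by positivity
      linarith
    · have h1 : |u n x - c| ≤ (2 * u n x ^ 2 + 2 * c ^ 2) / M := by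
        rw [le_div_iff₀ hM]
        nlinarith [sq_abs (u n x - c), sq_nonneg (u n x + c), abs_nonneg (u n x - c)]
      have : 0 ≤ min |u n x - c| M := le_min (abs_nonneg _) hM.le
      linarith
  rw [Metric.tendsto_nhds]
  intro ε hε
  have hM : 0 < 2 * (B + 1) / ε := by positivity
  filter_upwards [(hmin _ hM.le).eventually_lt_const (half_pos hε)] with n hn
  rw [Real.dist_eq]
  refine (hle _ hM n).trans_lt ?_
  have : B / (2 * (B + 1) / ε) < ε / 2 := by
    rw [div_lt_iff₀ hM]
    field_simp
    linarith
  linarith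

theorem continuous_trigVar (ρ : ℕ → ℝ) (n : ℕ) : Continuous (trigVar ρ n) := by
  unfold trigVar
  fun_prop

theorem continuous_trigCov (ρ : ℕ → ℝ) (n : ℕ) : Continuous (trigCov ρ n) := by
  unfold trigCov
  fun_prop

theorem continuous_trigDerivVar (ρ : ℕ → ℝ) (n : ℕ) : Continuous (trigDerivVar ρ n) := by
  unfold trigDerivVar
  fun_prop

theorem integral_trigVar (ρ : ℕ → ℝ) (n : ℕ) :
    ∫ t in (0 : ℝ)..(2 * Real.pi), trigVar ρ n t = 2 * Real.pi * ρ 0 * n := by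
  simp_rw [trigVar_eq_sum]
  rw [intervalIntegral.integral_finsetSum
    (fun M _ => (continuous_spectralSum ρ M).intervalIntegrable _ _)]
  have h : ∀ M ∈ Finset.range n, ∫ t in (0 : ℝ)..(2 * Real.pi), spectralSum ρ M t =
      2 * Real.pi * ρ 0 := by
    intro M _
    have := integral_spectralSum_mul_cos ρ (M := M) (m := 0) (by simp) 0
    simpa using this
  rw [Finset.sum_congr rfl h, Finset.sum_const, Finset.card_range, nsmul_eq_mul]
  ring

theorem integral_trigDerivVar (ρ : ℕ → ℝ) (n : ℕ) :
    ∫ t in (0 : ℝ)..(2 * Real.pi), trigDerivVar ρ n t =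
      2 * Real.pi * ρ 0 * ∑ m ∈ Finset.range n, ((m : ℝ) + 1) ^ 2 := by
  simp_rw [trigDerivVar_eq_sum]
  rw [intervalIntegral.integral_finsetSum
    (fun M _ => ((continuous_trigVar ρ (M + 1)).const_mul _).intervalIntegrable _ _),
    Finset.mul_sum]
  refine Finset.sum_congr rfl fun m _ => ?_
  rw [intervalIntegral.integral_const_mul, integral_trigVar]
  push_cast
  ring

/-- The density of zeros of `f_n` in the Kac-Rice formula. -/
noncomputable def zeroDensity (ρ : ℕ → ℝ) (n : ℕ) (t : ℝ) : ℝ :=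
  1 / Real.pi * √(trigVar ρ n t * trigDerivVar ρ n t - trigCov ρ n t ^ 2) / trigVar ρ n t

variable {ρ : ℕ → ℝ} {ψ : ℝ → ℝ}

theorem continuous_zeroDensity {n : ℕ} (hV : ∀ t, 0 < trigVar ρ n t) :
    Continuous (zeroDensity ρ n) := by
  have h1 := continuous_trigVar ρ n
  have h2 := continuous_trigCov ρ n
  have h3 := continuous_trigDerivVar ρ n
  exact (continuous_const.mul ((h1.mul h3).sub (h2.pow 2)).sqrt).div h1 fun t => (hV t).ne'

theorem zeroDensity_nonneg {n : ℕ} {t : ℝ} (hV : 0 < trigVar ρ n t) : 0 ≤ zeroDensity ρ n t := by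
  unfold zeroDensity
  positivity

/-- The powers balance: V D and C² both scale like n⁴. In the limit ψ cancels, so the constant does
not depend on the correlation. -/
theorem tendsto_zeroDensity_div (hψ : IsSpectralFunction ρ ψ) (hpos : ∀ n t, 0 ≤ trigVar ρ n t)
    (hψ0 : ∀ x ∈ Set.Ioo 0 (2 * Real.pi), 0 < ψ x)
    (hc : ContinuousOn ψ (Set.Ioo 0 (2 * Real.pi))) {t : ℝ} (ht : t ∈ Set.Ioo 0 (2 * Real.pi)) :
    Tendsto (fun n : ℕ => zeroDensity ρ n t / n) atTop (𝓝 (1 / (Real.pi * √3))) := by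
  have hS := hψ.tendsto_spectralSum ht
  have hψt := hψ0 t ht
  have hC := tendsto_trigCov_div hψ hpos hψ0 ht (hc.continuousAt (isOpen_Ioo.mem_nhds ht))
  have h := ((((tendsto_trigVar_div hS).mul (tendsto_trigDerivVar_div hS)).sub
    (hC.pow 2)).sqrt.const_mul (1 / Real.pi)).div (tendsto_trigVar_div hS) hψt.ne'
  have hval : 1 / Real.pi * √(ψ t * (ψ t / 3) - 0 ^ 2) / ψ t = 1 / (Real.pi * √3) := by
    rw [show ψ t * (ψ t / 3) - 0 ^ 2 = ψ t ^ 2 / 3 by ring, Real.sqrt_div (sq_nonneg _),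
      Real.sqrt_sq hψt.le]
    field_simp
  rw [hval] at h
  refine h.congr' ?_
  filter_upwards [eventually_gt_atTop 0] with n hn
  have hn' : (0 : ℝ) < n := by exact_mod_cast hn
  have e : trigVar ρ n t / n * (trigDerivVar ρ n t / (n : ℝ) ^ 3) -
      (trigCov ρ n t / (n : ℝ) ^ 2) ^ 2 =
      (trigVar ρ n t * trigDerivVar ρ n t - trigCov ρ n t ^ 2) / ((n : ℝ) ^ 2) ^ 2 := by
    field_simp
  simp only [Pi.div_apply]
  rw [e, Real.sqrt_div' _ (by positivity), Real.sqrt_sq (by positivity), zeroDensity]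
  rcases eq_or_ne (trigVar ρ n t) 0 with h0 | h0
  · simp [h0]
  · field_simp

/-- Dropping C² leaves D/V, and V ≥ γn. The integral of D is explicit, so this gives an L² bound
even where ψ is unbounded near 0 and 2π. -/
theorem zeroDensity_div_sq_le {γ : ℝ} (hγ : 0 < γ) {n : ℕ} (hn : 1 ≤ n) {t : ℝ}
    (hV : γ * n ≤ trigVar ρ n t) (hD : 0 ≤ trigDerivVar ρ n t) :
    (zeroDensity ρ n t / n) ^ 2 ≤ trigDerivVar ρ n t / (Real.pi ^ 2 * γ * (n : ℝ) ^ 3) := by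
  have hn' : (0 : ℝ) < n := by exact_mod_cast hn
  have hV0 : 0 < trigVar ρ n t := (mul_pos hγ hn').trans_le hV
  have h1 : √(trigVar ρ n t * trigDerivVar ρ n t - trigCov ρ n t ^ 2) ^ 2 ≤
      trigVar ρ n t * trigDerivVar ρ n t := by
    rw [← Real.sq_sqrt (mul_nonneg hV0.le hD)]
    gcongr
    rw [Real.sq_sqrt (mul_nonneg hV0.le hD)]
    linarith [sq_nonneg (trigCov ρ n t)]
  calc (zeroDensity ρ n t / n) ^ 2
      = √(trigVar ρ n t * trigDerivVar ρ n t - trigCov ρ n t ^ 2) ^ 2 /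
          (Real.pi ^ 2 * trigVar ρ n t ^ 2 * (n : ℝ) ^ 2) := by
        rw [zeroDensity]
        field_simp
    _ ≤ trigVar ρ n t * trigDerivVar ρ n t / (Real.pi ^ 2 * trigVar ρ n t ^ 2 * (n : ℝ) ^ 2) := by
        gcongr
    _ = trigDerivVar ρ n t / (Real.pi ^ 2 * trigVar ρ n t * (n : ℝ) ^ 2) := by
        field_simp
    _ ≤ trigDerivVar ρ n t / (Real.pi ^ 2 * (γ * n) * (n : ℝ) ^ 2) := by
        gcongr
    _ = trigDerivVar ρ n t / (Real.pi ^ 2 * γ * (n : ℝ) ^ 3) := by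
        congr 1
        ring

theorem tendsto_integral_zeroDensity_div (hψ : IsSpectralFunction ρ ψ) (hρ : ρ 0 = 1)
    (hpos : ∀ n t, 0 ≤ trigVar ρ n t)
    (hD : ∀ n t, 0 ≤ trigDerivVar ρ n t)
    (hc : ContinuousOn ψ (Set.Ioo 0 (2 * Real.pi))) {γ : ℝ} (hγ : 0 < γ)
    (hψγ : ∀ x ∈ Set.Ioo 0 (2 * Real.pi), γ ≤ ψ x) :
    Tendsto (fun n : ℕ => (∫ t in Set.Ioo 0 (2 * Real.pi), zeroDensity ρ n t) / n) atTop
      (𝓝 (2 / √3)) := by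
  have hψ0 : ∀ x ∈ Set.Ioo 0 (2 * Real.pi), 0 < ψ x := fun x hx => hγ.trans_le (hψγ x hx)
  have hγV := mul_le_trigVar hψ hpos hψγ
  have hV : ∀ (n : ℕ) t, 0 < trigVar ρ (n + 1) t := fun n t =>
    (by positivity : 0 < γ * ((n + 1 : ℕ) : ℝ)).trans_le (hγV (n + 1) t)
  have hint : ∀ {f : ℝ → ℝ}, Continuous f → IntegrableOn f (Set.Ioo 0 (2 * Real.pi)) := fun hf =>
    hf.integrableOn_Icc.mono_set Set.Ioo_subset_Icc_self
  have hcont : ∀ n : ℕ, Continuous fun t => zeroDensity ρ (n + 1) t / ((n + 1 : ℕ) : ℝ) := fun n =>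
    (continuous_zeroDensity (hV n)).div_const _
  have hpi : (0 : ℝ) ≤ 2 * Real.pi := by positivity
  have h := tendsto_integral_of_tendsto_of_integral_sq_le
    (μ := volume.restrict (Set.Ioo 0 (2 * Real.pi)))
    (u := fun n t => zeroDensity ρ (n + 1) t / ((n + 1 : ℕ) : ℝ)) (c := 1 / (Real.pi * √3))
    (K := 2 * Real.pi / (Real.pi ^ 2 * γ)) (fun n => hint (hcont n))
    (fun n => hint ((hcont n).pow 2)) ?_ ?_
  · rw [← tendsto_add_atTop_iff_nat 1]
    have hval : ∫ _ in Set.Ioo 0 (2 * Real.pi), 1 / (Real.pi * √3) = 2 / √3 := by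
      rw [setIntegral_const, Real.volume_real_Ioo_of_le hpi, smul_eq_mul]
      field_simp
      ring
    rw [hval] at h
    refine h.congr fun n => ?_
    rw [integral_div]
  · intro n
    have hn0 : (0 : ℝ) < ((n + 1 : ℕ) : ℝ) := by positivity
    calc ∫ t in Set.Ioo 0 (2 * Real.pi), (zeroDensity ρ (n + 1) t / ((n + 1 : ℕ) : ℝ)) ^ 2
        ≤ ∫ t in Set.Ioo 0 (2 * Real.pi), trigDerivVar ρ (n + 1) t /
            (Real.pi ^ 2 * γ * ((n + 1 : ℕ) : ℝ) ^ 3) :=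
          integral_mono (hint ((hcont n).pow 2))
            (hint ((continuous_trigDerivVar ρ (n + 1)).div_const _)) fun t =>
            zeroDensity_div_sq_le hγ (Nat.le_add_left 1 n) (hγV (n + 1) t) (hD (n + 1) t)
      _ = 2 * Real.pi * (∑ m ∈ Finset.range (n + 1), ((m : ℝ) + 1) ^ 2) /
            (Real.pi ^ 2 * γ * ((n + 1 : ℕ) : ℝ) ^ 3) := by
          rw [integral_div, ← integral_Ioc_eq_integral_Ioo, ← intervalIntegral.integral_of_le hpi,
            integral_trigDerivVar, hρ, mul_one]
      _ ≤ 2 * Real.pi * ((n + 1 : ℕ) : ℝ) ^ 3 / (Real.pi ^ 2 * γ * ((n + 1 : ℕ) : ℝ) ^ 3) := by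
          gcongr
          calc ∑ m ∈ Finset.range (n + 1), ((m : ℝ) + 1) ^ 2
              ≤ ∑ m ∈ Finset.range (n + 1), ((n + 1 : ℕ) : ℝ) ^ 2 := by
                refine Finset.sum_le_sum fun m hm => ?_
                have : m + 1 ≤ n + 1 := Finset.mem_range.1 hm
                have : ((m : ℝ) + 1) ≤ ((n + 1 : ℕ) : ℝ) := by exact_mod_cast this
                gcongr
            _ = ((n + 1 : ℕ) : ℝ) ^ 3 := by
                rw [Finset.sum_const, Finset.card_range, nsmul_eq_mul]
                ring
      _ = 2 * Real.pi / (Real.pi ^ 2 * γ) := by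
          field_simp
  · refine (ae_restrict_iff' measurableSet_Ioo).2 (Eventually.of_forall fun t ht => ?_)
    exact (tendsto_add_atTop_iff_nat 1).2 (tendsto_zeroDensity_div hψ hpos hψ0 hc ht)

/-- The expected number of zeros under the spectral hypotheses. -/
theorem expected_numZeros {Ω : Type*} [MeasurableSpace Ω] {P : Measure Ω} {a b : ℕ → Ω → ℝ}
    (ha : IsStandardStationaryGaussian P ρ a) (hb : IsStandardStationaryGaussian P ρ b)
    (hab : IndepFun (fun ω k => a k ω) (fun ω k => b k ω) P) (hS : SpectralHypotheses ρ) :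
    (∀ n : ℕ, 1 ≤ n → AEMeasurable (numZeros a b n) P ∧ ∫⁻ ω, numZeros a b n ω ∂P < ∞) ∧
      (fun n : ℕ => (∫⁻ ω, numZeros a b n ω ∂P).toReal)
        ~[atTop] (fun n : ℕ => 2 * (n : ℝ) / √3) := by
  obtain ⟨ψ, hψ, -, hc, γ, hγ, hψγ⟩ := hS
  have hpos : ∀ n t, 0 ≤ trigVar ρ n t := fun n t => by
    rw [← integral_trigPoly_sq ha hb hab]
    exact integral_nonneg fun ω => mul_self_nonneg _
  have hD : ∀ n t, 0 ≤ trigDerivVar ρ n t := fun n t => by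
    rw [← integral_trigPolyDeriv_sq ha hb hab]
    exact integral_nonneg fun ω => mul_self_nonneg _
  have hV : ∀ n : ℕ, 1 ≤ n → ∀ t, 0 < trigVar ρ n t := fun n hn t => by
    have hn' : (0 : ℝ) < n := by exact_mod_cast hn
    exact (mul_pos hγ hn').trans_le (mul_le_trigVar hψ hpos hψγ n t)
  have hkr : ∀ n : ℕ, 1 ≤ n → ∫⁻ ω, numZeros a b n ω ∂P =
      ENNReal.ofReal (∫ t in Set.Ioo 0 (2 * Real.pi), zeroDensity ρ n t) := by
    intro n hn
    rw [(kacRice ha hb hab hn (hV n hn)).2, ofReal_integral_eq_lintegral_ofReal]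
    · rfl
    · exact (continuous_zeroDensity (hV n hn)).integrableOn_Icc.mono_set Set.Ioo_subset_Icc_self
    · exact Eventually.of_forall fun t => zeroDensity_nonneg (hV n hn t)
  refine ⟨fun n hn => ⟨(kacRice ha hb hab hn (hV n hn)).1, ?_⟩, ?_⟩
  · rw [hkr n hn]
    exact ENNReal.ofReal_lt_top
  · have h := tendsto_integral_zeroDensity_div hψ ha.standard hpos hD hc hγ hψγ
    have h3 : (0 : ℝ) < √3 := by positivity
    rw [isEquivalent_iff_tendsto_one]
    · have h' := h.div_const (2 / √3)
      rw [div_self (by positivity)] at h'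
      refine h'.congr' ?_
      filter_upwards [eventually_ge_atTop 1] with n hn
      rw [Pi.div_apply, hkr n hn, ENNReal.toReal_ofReal
        (integral_nonneg fun t => zeroDensity_nonneg (hV n hn t))]
      field_simp
    · filter_upwards [eventually_ge_atTop 1] with n hn
      have hn' : (0 : ℝ) < n := by exact_mod_cast hn
      positivity

end Limit

/-! ### Cosine series of convex sequences. -/

section ConvexSequence

/-- With x = 1, y = 0 the kernel is n times the Fejér kernel, that is, the sum of the first n
Dirichlet kernels. -/
theorem trigKernel_succ (n : ℕ) (x : ℝ) :
    trigKernel (n + 1) 1 0 x = trigKernel n 1 0 x + spectralSum (fun _ => 1) n x := by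
  have h : ∀ n, trigKernel n 1 0 x = trigVar (fun _ => 1) n x := fun n => by
    simp [trigKernel_eq_sum, trigVar]
  rw [h, h, trigVar_succ]

theorem spectralSum_succ (ρ : ℕ → ℝ) (n : ℕ) (x : ℝ) :
    spectralSum ρ (n + 1) x = spectralSum ρ n x + ρ (n + 1) *
      (spectralSum (fun _ => 1) (n + 1) x - spectralSum (fun _ => 1) n x) := by
  simp only [spectralSum_eq, Finset.sum_range_succ]
  ring

/-- Double summation by parts. -/
theorem spectralSum_eq_sum_trigKernel (ρ : ℕ → ℝ) (N : ℕ) (x : ℝ) :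
    spectralSum ρ N x =
      ∑ m ∈ Finset.range N, (ρ m - 2 * ρ (m + 1) + ρ (m + 2)) * trigKernel (m + 1) 1 0 x +
        (ρ N - ρ (N + 1)) * trigKernel N 1 0 x + ρ N * spectralSum (fun _ => 1) N x := by
  induction N with
  | zero => simp [spectralSum_eq, trigKernel]
  | succ N ih =>
    rw [spectralSum_succ, ih, Finset.sum_range_succ]
    have := trigKernel_succ N x
    linear_combination -(ρ N - ρ (N + 1)) * this

/-- The sine parts cancel under k ↦ -k. -/
theorem spectralSum_ofReal_eq (ρ : ℕ → ℝ) (N : ℕ) (x : ℝ) :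
    ∑ k ∈ Finset.Icc (-(N : ℤ)) (N : ℤ),
      (ρ k.natAbs : ℂ) * Complex.exp (Complex.I * (k : ℂ) * (x : ℂ)) = (spectralSum ρ N x : ℂ) := by
  have hterm : ∀ k : ℤ, (ρ k.natAbs : ℂ) * Complex.exp (Complex.I * (k : ℂ) * (x : ℂ)) =
      ((ρ k.natAbs * Real.cos (k * x) : ℝ) : ℂ) +
        ((ρ k.natAbs * Real.sin (k * x) : ℝ) : ℂ) * Complex.I := by
    intro k
    rw [show Complex.I * (k : ℂ) * (x : ℂ) = ((k * x : ℝ) : ℂ) * Complex.I by push_cast; ring,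
      Complex.exp_mul_I]
    push_cast
    ring
  have hodd : ∑ k ∈ Finset.Icc (-(N : ℤ)) (N : ℤ), ρ k.natAbs * Real.sin (k * x) = 0 := by
    have h : ∑ k ∈ Finset.Icc (-(N : ℤ)) (N : ℤ), ρ k.natAbs * Real.sin (k * x) =
        ∑ k ∈ Finset.Icc (-(N : ℤ)) (N : ℤ), -(ρ k.natAbs * Real.sin (k * x)) := by
      refine Finset.sum_nbij' (fun k => -k) (fun k => -k) ?_ ?_ (fun k _ => neg_neg k)
        (fun k _ => neg_neg k) fun k _ => ?_
      · intro k hk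
        rw [Finset.mem_Icc] at hk ⊢
        omega
      · intro k hk
        rw [Finset.mem_Icc] at hk ⊢
        omega
      · rw [Int.natAbs_neg]
        push_cast
        rw [neg_mul, Real.sin_neg]
        ring
    rw [Finset.sum_neg_distrib] at h
    linarith
  simp_rw [hterm, Finset.sum_add_distrib, ← Finset.sum_mul, ← Complex.ofReal_sum]
  rw [hodd]
  simp [spectralSum]

variable {ρ : ℕ → ℝ}

theorem antitone_sub_of_convex (hconv : ∀ k, 0 ≤ ρ k - 2 * ρ (k + 1) + ρ (k + 2)) :
    Antitone fun k => ρ k - ρ (k + 1) :=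
  antitone_nat_of_succ_le fun k => by
    have := hconv k
    change ρ (k + 1) - ρ (k + 2) ≤ _
    linarith

theorem sub_nonneg_of_convex (hconv : ∀ k, 0 ≤ ρ k - 2 * ρ (k + 1) + ρ (k + 2))
    (hlim : Tendsto ρ atTop (𝓝 0)) (k : ℕ) : 0 ≤ ρ k - ρ (k + 1) := by
  have h : Tendsto (fun k => ρ k - ρ (k + 1)) atTop (𝓝 (0 - 0)) :=
    hlim.sub (hlim.comp (tendsto_add_atTop_nat 1))
  rw [sub_zero] at h
  exact (antitone_sub_of_convex hconv).le_of_tendsto h k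

theorem nonneg_of_convex (hconv : ∀ k, 0 ≤ ρ k - 2 * ρ (k + 1) + ρ (k + 2))
    (hlim : Tendsto ρ atTop (𝓝 0)) (k : ℕ) : 0 ≤ ρ k :=
  (antitone_nat_of_succ_le fun k =>
    sub_nonneg.1 (sub_nonneg_of_convex hconv hlim k)).le_of_tendsto hlim k

/-- The partial sums telescope to ρ(0) minus nonnegative terms. The weight m + 1 is the integral of
the corresponding kernel divided by 2π, so this is what makes ψ integrable. -/
theorem summable_mul_of_convex (hconv : ∀ k, 0 ≤ ρ k - 2 * ρ (k + 1) + ρ (k + 2))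
    (hlim : Tendsto ρ atTop (𝓝 0)) :
    Summable fun m : ℕ => ((m : ℝ) + 1) * (ρ m - 2 * ρ (m + 1) + ρ (m + 2)) := by
  have hsum : ∀ N : ℕ, ∑ m ∈ Finset.range N, ((m : ℝ) + 1) * (ρ m - 2 * ρ (m + 1) + ρ (m + 2)) =
      ρ 0 - ρ N - N * (ρ N - ρ (N + 1)) := by
    intro N
    induction N with
    | zero => simp
    | succ N ih =>
      rw [Finset.sum_range_succ, ih]
      push_cast
      ring
  refine summable_of_sum_range_le (c := ρ 0) (fun m => mul_nonneg (by positivity) (hconv m))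
    fun N => ?_
  rw [hsum]
  have h1 := nonneg_of_convex hconv hlim N
  have h2 := mul_nonneg (Nat.cast_nonneg (α := ℝ) N) (sub_nonneg_of_convex hconv hlim N)
  linarith

theorem summable_of_convex (hconv : ∀ k, 0 ≤ ρ k - 2 * ρ (k + 1) + ρ (k + 2))
    (hlim : Tendsto ρ atTop (𝓝 0)) :
    Summable fun m : ℕ => ρ m - 2 * ρ (m + 1) + ρ (m + 2) :=
  Summable.of_nonneg_of_le hconv (fun m => by
    have := mul_nonneg (Nat.cast_nonneg (α := ℝ) m) (hconv m)
    linarith) (summable_mul_of_convex hconv hlim)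

theorem two_sub_two_mul_cos_pos {x : ℝ} (hx : x ∈ Set.Ioo 0 (2 * Real.pi)) :
    0 < 2 - 2 * Real.cos x := by
  have h1 : Real.cos x ≠ 1 := fun h => by
    rw [Real.cos_eq_one_iff_of_lt_of_lt (by linarith [hx.1, Real.pi_pos]) hx.2] at h
    exact hx.1.ne' h
  have h2 := lt_of_le_of_ne (Real.cos_le_one x) h1
  linarith

theorem two_sub_two_mul_cos_mul_trigKernel_le (n : ℕ) (x : ℝ) :
    (2 - 2 * Real.cos x) * trigKernel n 1 0 x ≤ 4 := by
  have := trigKernel_mul_le n 1 0 x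
  norm_num at this
  exact this

theorem trigKernel_le_div (n : ℕ) {x : ℝ} (hx : x ∈ Set.Ioo 0 (2 * Real.pi)) :
    trigKernel n 1 0 x ≤ 4 / (2 - 2 * Real.cos x) := by
  rw [le_div_iff₀ (two_sub_two_mul_cos_pos hx), mul_comm]
  exact two_sub_two_mul_cos_mul_trigKernel_le n x

/-- A convex sequence which tends to zero satisfies the spectral hypotheses. -/
theorem spectralHypotheses_of_convex (hconv : ∀ k, 0 ≤ ρ k - 2 * ρ (k + 1) + ρ (k + 2))
    (hconv0 : 0 < ρ 0 - 2 * ρ 1 + ρ 2) (hlim : Tendsto ρ atTop (𝓝 0)) : SpectralHypotheses ρ := by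
  set c : ℕ → ℝ := fun m => ρ m - 2 * ρ (m + 1) + ρ (m + 2) with hc
  have hcs : Summable c := summable_of_convex hconv hlim
  have hsummable : ∀ x ∈ Set.Ioo 0 (2 * Real.pi),
      Summable fun m => c m * trigKernel (m + 1) 1 0 x := fun x hx =>
    Summable.of_nonneg_of_le (fun m => mul_nonneg (hconv m) (trigKernel_nonneg _ _ _ _))
      (fun m => mul_le_mul_of_nonneg_left (trigKernel_le_div (m + 1) hx) (hconv m))
      (hcs.mul_right _)
  have hcontOn : ContinuousOn (fun x => ∑' m, c m * trigKernel (m + 1) 1 0 x)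
      (Set.Ioo 0 (2 * Real.pi)) := by
    -- The factor 2 - 2 cos x makes the terms uniformly bounded by 4 c_m, so the product is
    -- continuous everywhere; it is divided out inside ]0, 2π[.
    have hcont : Continuous fun x => ∑' m, c m * ((2 - 2 * Real.cos x) *
        trigKernel (m + 1) 1 0 x) := by
      refine continuous_tsum (fun m => ?_) (hcs.mul_right 4) fun m x => ?_
      · have := continuous_trigKernel (m + 1) 1 0
        fun_prop
      · have h0 : 0 ≤ 2 - 2 * Real.cos x := by linarith [Real.cos_le_one x]
        rw [Real.norm_eq_abs, abs_of_nonneg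
          (mul_nonneg (hconv m) (mul_nonneg h0 (trigKernel_nonneg _ _ _ _)))]
        exact mul_le_mul_of_nonneg_left (two_sub_two_mul_cos_mul_trigKernel_le _ _) (hconv m)
    refine (hcont.continuousOn.div (f := fun x => ∑' m, c m * ((2 - 2 * Real.cos x) *
        trigKernel (m + 1) 1 0 x)) (g := fun x => 2 - 2 * Real.cos x) (by fun_prop)
      fun x hx => (two_sub_two_mul_cos_pos hx).ne').congr fun x hx => ?_
    have h0 := two_sub_two_mul_cos_pos hx
    change _ = (∑' m, c m * ((2 - 2 * Real.cos x) * trigKernel (m + 1) 1 0 x)) /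
      (2 - 2 * Real.cos x)
    rw [eq_div_iff h0.ne', ← tsum_mul_right]
    refine tsum_congr fun m => by ring
  refine ⟨fun x => ∑' m, c m * trigKernel (m + 1) 1 0 x, ?_, ?_, hcontOn, c 0, hconv0, ?_⟩
  · intro x hx
    simp_rw [spectralSum_ofReal_eq]
    refine (Complex.continuous_ofReal.tendsto _).comp ?_
    have hbK : ∀ n, |trigKernel n 1 0 x| ≤ 4 / (2 - 2 * Real.cos x) := fun n => by
      rw [abs_of_nonneg (trigKernel_nonneg _ _ _ _)]
      exact trigKernel_le_div n hx
    -- The Dirichlet kernel is a difference of two nonnegative kernels with this bound. Hence both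
    -- boundary terms of the summation by parts vanish in the limit.
    have hbD : ∀ n, |spectralSum (fun _ => 1) n x| ≤ 4 / (2 - 2 * Real.cos x) := fun n => by
      have h1 := trigKernel_succ n x
      have h2 := trigKernel_nonneg n 1 0 x
      have h3 := trigKernel_nonneg (n + 1) 1 0 x
      have h4 := trigKernel_le_div n hx
      have h5 := trigKernel_le_div (n + 1) hx
      rw [abs_le]
      constructor <;> linarith
    have hmul : ∀ {u v : ℕ → ℝ} {B : ℝ}, Tendsto u atTop (𝓝 0) → (∀ n, |v n| ≤ B) →
        Tendsto (fun n => u n * v n) atTop (𝓝 0) := fun hu hv =>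
      hu.zero_mul_isBoundedUnder_le (isBoundedUnder_of ⟨_, hv⟩)
    have hd : Tendsto (fun k => ρ k - ρ (k + 1)) atTop (𝓝 0) := by
      simpa using hlim.sub (hlim.comp (tendsto_add_atTop_nat 1))
    have h := (((hsummable x hx).hasSum.tendsto_sum_nat).add (hmul hd hbK)).add (hmul hlim hbD)
    rw [add_zero, add_zero] at h
    exact h.congr fun N => (spectralSum_eq_sum_trigKernel ρ N x).symm
  · refine ⟨hcontOn.aestronglyMeasurable measurableSet_Ioo, ?_⟩
    have hpi : (0 : ℝ) ≤ 2 * Real.pi := by positivity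
    have hnn : ∀ m x, 0 ≤ c m * trigKernel (m + 1) 1 0 x := fun m x =>
      mul_nonneg (hconv m) (trigKernel_nonneg _ _ _ _)
    have hK : ∀ m, Continuous fun x => c m * trigKernel (m + 1) 1 0 x := fun m =>
      (continuous_trigKernel (m + 1) 1 0).const_mul _
    have hKint : ∀ m, ∫⁻ x in Set.Ioo 0 (2 * Real.pi),
        ENNReal.ofReal (c m * trigKernel (m + 1) 1 0 x) =
        ENNReal.ofReal (2 * Real.pi * (((m : ℝ) + 1) * c m)) := by
      intro m
      rw [← ofReal_integral_eq_lintegral_ofReal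
        ((hK m).integrableOn_Icc.mono_set Set.Ioo_subset_Icc_self)
        (Eventually.of_forall (hnn m)), ← integral_Ioc_eq_integral_Ioo,
        ← intervalIntegral.integral_of_le hpi, intervalIntegral.integral_const_mul]
      have := integral_trigKernel (m + 1) 1 0 0
      simp only [sub_zero] at this
      rw [this]
      congr 1
      push_cast
      ring
    rw [hasFiniteIntegral_iff_ofReal (Eventually.of_forall fun x => tsum_nonneg (hnn · x))]
    calc ∫⁻ x in Set.Ioo 0 (2 * Real.pi), ENNReal.ofReal (∑' m, c m * trigKernel (m + 1) 1 0 x)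
        = ∫⁻ x in Set.Ioo 0 (2 * Real.pi),
            ∑' m, ENNReal.ofReal (c m * trigKernel (m + 1) 1 0 x) :=
          setLIntegral_congr_fun measurableSet_Ioo fun x hx =>
            ENNReal.ofReal_tsum_of_nonneg (hnn · x) (hsummable x hx)
      _ = ∑' m : ℕ, ENNReal.ofReal (2 * Real.pi * (((m : ℝ) + 1) * c m)) := by
          rw [lintegral_tsum fun m => (hK m).measurable.ennreal_ofReal.aemeasurable]
          exact tsum_congr hKint
      _ < ∞ := by
          have hs := (summable_mul_of_convex hconv hlim).mul_left (2 * Real.pi)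
          rw [← ENNReal.ofReal_tsum_of_nonneg (fun m => mul_nonneg hpi
            (mul_nonneg (by positivity) (hconv m))) hs]
          exact ENNReal.ofReal_lt_top
  · intro x hx
    -- The term m = 0 is the constant c_0, since the kernel of order 1 is 1.
    have h := (hsummable x hx).le_tsum 0 fun m _ =>
      mul_nonneg (hconv m) (trigKernel_nonneg _ _ _ _)
    simpa [trigKernel] using h

end ConvexSequence

/-! ### Fractional Gaussian noise. -/

section FractionalNoise

variable {p : ℝ}

theorem hasDerivAt_rpow_add_const (c : ℝ) {x : ℝ} (hx : 0 < x + c) (q : ℝ) :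
    HasDerivAt (fun y => (y + c) ^ q) (q * (x + c) ^ (q - 1)) x := by
  have h := ((hasDerivAt_id x).add_const c).rpow_const (p := q) (Or.inl hx.ne')
  simpa using h

/-- The second central difference of a power with exponent between `1` and `2` is convex. -/
theorem convexOn_second_difference_rpow (hp1 : 1 < p) (hp2 : p < 2) :
    ConvexOn ℝ (Set.Ici 1) fun x : ℝ => (x + 1) ^ p + (x + -1) ^ p - 2 * x ^ p := by
  have hder : ∀ q : ℝ, ∀ x ∈ Set.Ioi (1 : ℝ), HasDerivWithinAt
      (fun x : ℝ => (x + 1) ^ q + (x + -1) ^ q - 2 * x ^ q)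
      (q * ((x + 1) ^ (q - 1) + (x + -1) ^ (q - 1) - 2 * x ^ (q - 1))) (Set.Ioi 1) x := by
    intro q x hx
    have hx' : 1 < x := hx
    have h0 := hasDerivAt_rpow_add_const 0 (x := x) (by linarith) q
    simp only [add_zero] at h0
    have h := ((hasDerivAt_rpow_add_const 1 (x := x) (by linarith) q).add
      (hasDerivAt_rpow_add_const (-1) (x := x) (by linarith) q)).sub (h0.const_mul 2)
    refine (h.congr_deriv ?_).hasDerivWithinAt
    ring
  refine convexOn_of_hasDerivWithinAt2_nonneg (convex_Ici 1)
    (f' := fun x => p * ((x + 1) ^ (p - 1) + (x + -1) ^ (p - 1) - 2 * x ^ (p - 1)))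
    (f'' := fun x => p * ((p - 1) *
      ((x + 1) ^ (p - 1 - 1) + (x + -1) ^ (p - 1 - 1) - 2 * x ^ (p - 1 - 1)))) ?_ ?_ ?_ ?_
  · have hc : ∀ c : ℝ, Continuous fun x : ℝ => (x + c) ^ p := fun c =>
      (continuous_id.add continuous_const).rpow_const fun x => Or.inr (by linarith)
    have h0 := hc 0
    simp only [add_zero] at h0
    exact (((hc 1).add (hc (-1))).sub (h0.const_mul 2)).continuousOn
  · rw [interior_Ici]
    exact hder p
  · rw [interior_Ici]
    exact fun x hx => (hder (p - 1) x hx).const_mul p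
  · rw [interior_Ici]
    intro x hx
    have hx' : 1 < x := hx
    have h1 : 0 < x + 1 := by linarith
    have h2 : 0 < x + -1 := by linarith
    have h3 : 0 < x := by linarith
    -- Halving the exponent makes the powers squares A², B², X². Then A² + B² ≥ 2AB ≥ 2X², because
    -- (x + 1)(x - 1) ≤ x² and r ≤ 0.
    set r : ℝ := (p - 1 - 1) / 2 with hr
    have hr0 : r ≤ 0 := by rw [hr]; linarith
    have hsq : ∀ y : ℝ, 0 < y → y ^ (p - 1 - 1) = (y ^ r) ^ 2 := fun y hy => by
      rw [← Real.rpow_natCast, ← Real.rpow_mul hy.le, hr]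
      norm_num
    have hmul : x ^ r * x ^ r ≤ (x + 1) ^ r * (x + -1) ^ r := by
      rw [← Real.mul_rpow h3.le h3.le, ← Real.mul_rpow h1.le h2.le]
      exact Real.rpow_le_rpow_of_nonpos (mul_pos h1 h2) (by nlinarith) hr0
    have hnn : 0 ≤ (x + 1) ^ (p - 1 - 1) + (x + -1) ^ (p - 1 - 1) - 2 * x ^ (p - 1 - 1) := by
      rw [hsq _ h1, hsq _ h2, hsq _ h3]
      nlinarith [sq_nonneg ((x + 1) ^ r - (x + -1) ^ r)]
    exact mul_nonneg (by linarith) (mul_nonneg (by linarith) hnn)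

/-- The mean value theorem, applied twice, yields a second derivative at a point of ]x - 1, x + 1[;
the power p - 2 is negative, so the left end dominates. -/
theorem second_difference_rpow_bounds (hp1 : 1 < p) (hp2 : p < 2) {x : ℝ} (hx : 1 < x) :
    0 ≤ (x + 1) ^ p + (x + -1) ^ p - 2 * x ^ p ∧
      (x + 1) ^ p + (x + -1) ^ p - 2 * x ^ p ≤ p * ((p - 1) * 2) * (x - 1) ^ (p - 2) := by
  have hplus : ∀ s ∈ Set.Icc (0 : ℝ) 1, 0 < x + s := fun s hs => by linarith [hs.1]
  have hminus : ∀ s ∈ Set.Icc (0 : ℝ) 1, 0 < x - s := fun s hs => by linarith [hs.2]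
  have hder : ∀ s ∈ Set.Icc (0 : ℝ) 1, HasDerivAt (fun s : ℝ => (x + s) ^ p + (x - s) ^ p)
      (p * ((x + s) ^ (p - 1) - (x - s) ^ (p - 1))) s := by
    intro s hs
    have h1 := ((hasDerivAt_id s).const_add x).rpow_const (p := p) (Or.inl (hplus s hs).ne')
    have h2 := ((hasDerivAt_id s).const_sub x).rpow_const (p := p) (Or.inl (hminus s hs).ne')
    refine (h1.add h2).congr_deriv ?_
    simp only [id]
    ring
  obtain ⟨s, hs, hs'⟩ := exists_hasDerivAt_eq_slope (fun s : ℝ => (x + s) ^ p + (x - s) ^ p)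
    (fun s => p * ((x + s) ^ (p - 1) - (x - s) ^ (p - 1))) zero_lt_one
    (fun s hs => (hder s hs).continuousAt.continuousWithinAt)
    fun s hs => hder s (Set.Ioo_subset_Icc_self hs)
  have hval : (x + 1) ^ p + (x + -1) ^ p - 2 * x ^ p =
      p * ((x + s) ^ (p - 1) - (x - s) ^ (p - 1)) := by
    rw [hs']
    simp only [add_zero, sub_zero, div_one, ← sub_eq_add_neg]
    ring
  have hlt : x - s < x + s := by linarith [hs.1]
  have hxs : 0 < x - s := hminus s (Set.Ioo_subset_Icc_self hs)
  have hder' : ∀ y ∈ Set.Icc (x - s) (x + s), HasDerivAt (fun y : ℝ => y ^ (p - 1))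
      ((p - 1) * y ^ (p - 1 - 1)) y := fun y hy =>
    Real.hasDerivAt_rpow_const (Or.inl (hxs.trans_le hy.1).ne')
  obtain ⟨ξ, hξ, hξ'⟩ := exists_hasDerivAt_eq_slope (fun y : ℝ => y ^ (p - 1))
    (fun y => (p - 1) * y ^ (p - 1 - 1)) hlt
    (fun y hy => (hder' y hy).continuousAt.continuousWithinAt)
    fun y hy => hder' y (Set.Ioo_subset_Icc_self hy)
  have hs0 : 0 < s := hs.1
  have hval' : (x + s) ^ (p - 1) - (x - s) ^ (p - 1) = (p - 1) * ξ ^ (p - 2) * (2 * s) := by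
    rw [eq_div_iff (by linarith)] at hξ'
    rw [← hξ', show p - 1 - 1 = p - 2 by ring]
    ring
  have hξ0 : 0 < ξ := hxs.trans hξ.1
  have hξp : ξ ^ (p - 2) ≤ (x - 1) ^ (p - 2) :=
    Real.rpow_le_rpow_of_nonpos (by linarith) (by linarith [hξ.1, hs.2]) (by linarith)
  have hξ1 : 0 ≤ ξ ^ (p - 2) := Real.rpow_nonneg hξ0.le _
  have hp0 : 0 < p := by linarith
  have hp10 : 0 < p - 1 := by linarith
  rw [hval, hval']
  refine ⟨by positivity, ?_⟩
  calc p * ((p - 1) * ξ ^ (p - 2) * (2 * s)) = p * ((p - 1) * 2) * (s * ξ ^ (p - 2)) := by ring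
    _ ≤ p * ((p - 1) * 2) * (1 * (x - 1) ^ (p - 2)) := by
      have := hs.2.le
      gcongr
    _ = _ := by rw [one_mul]

/-- The expression vanishes at p = 2. Multiplied by 2^q, q = 2 - p, it becomes 7·2^q - 16 +
9(3/2)^(-q), and e^s ≥ 1 + s bounds this below by q(7 log 2 - 9 log(3/2)), which is positive as
(3/2)⁹ < 2⁷. -/
theorem seven_sub_four_mul_two_rpow_pos (hp2 : p < 2) :
    0 < 7 - 4 * (2 : ℝ) ^ p + (3 : ℝ) ^ p := by
  set q : ℝ := 2 - p with hq
  have hq0 : 0 < q := by rw [hq]; linarith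
  have hlog : 9 * Real.log (3 / 2) < 7 * Real.log 2 := by
    have h1 : 9 * Real.log (3 / 2) = Real.log ((3 / 2 : ℝ) ^ 9) := by
      rw [Real.log_pow]
      norm_num
    have h2 : 7 * Real.log 2 = Real.log ((2 : ℝ) ^ 7) := by
      rw [Real.log_pow]
      norm_num
    rw [h1, h2]
    exact Real.log_lt_log (by norm_num) (by norm_num)
  have h2 : 1 + q * Real.log 2 ≤ (2 : ℝ) ^ q := by
    rw [Real.rpow_def_of_pos two_pos]
    have := Real.add_one_le_exp (Real.log 2 * q)
    linarith
  have h3 : 1 - q * Real.log (3 / 2) ≤ (3 / 2 : ℝ) ^ (-q) := by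
    rw [Real.rpow_def_of_pos (by norm_num)]
    have := Real.add_one_le_exp (Real.log (3 / 2) * -q)
    linarith
  have e2 : (2 : ℝ) ^ p * (2 : ℝ) ^ q = 4 := by
    rw [← Real.rpow_add two_pos, hq]
    norm_num
  have e3 : (3 : ℝ) ^ p * (2 : ℝ) ^ q = 9 * (3 / 2 : ℝ) ^ (-q) := by
    rw [Real.div_rpow (by norm_num) (by norm_num), Real.rpow_neg two_pos.le, div_inv_eq_mul,
      ← mul_assoc]
    congr 1
    rw [show p = 2 + -q by rw [hq]; ring, Real.rpow_add (by norm_num)]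
    norm_num
  have hpos : (0 : ℝ) < 2 ^ q := Real.rpow_pos_of_pos two_pos q
  refine pos_of_mul_pos_left (b := (2 : ℝ) ^ q) ?_ hpos.le
  nlinarith

theorem fgnCorrelation_zero {H : ℝ} (hH : 0 < H) : fgnCorrelation H 0 = 1 := by
  rw [fgnCorrelation]
  norm_num [Real.zero_rpow (show 2 * H ≠ 0 by positivity)]

theorem fgnCorrelation_succ (H : ℝ) (k : ℕ) : fgnCorrelation H (k + 1) =
    1 / 2 * (((k : ℝ) + 2) ^ (2 * H) + (k : ℝ) ^ (2 * H) - 2 * ((k : ℝ) + 1) ^ (2 * H)) := by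
  rw [fgnCorrelation]
  push_cast
  rw [show (1 : ℝ) + ((k : ℝ) + 1) = k + 2 by ring, show (1 : ℝ) - ((k : ℝ) + 1) = -k by ring,
    abs_neg, abs_of_nonneg (by positivity : (0 : ℝ) ≤ (k : ℝ) + 2),
    abs_of_nonneg (Nat.cast_nonneg k), abs_of_nonneg (by positivity : (0 : ℝ) ≤ (k : ℝ) + 1)]

theorem fgnCorrelation_succ' (H : ℝ) (k : ℕ) : fgnCorrelation H (k + 1) =
    1 / 2 * (((k : ℝ) + 1 + 1) ^ (2 * H) + ((k : ℝ) + 1 + -1) ^ (2 * H) -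
      2 * ((k : ℝ) + 1) ^ (2 * H)) := by
  rw [fgnCorrelation_succ]
  ring_nf

variable {H : ℝ}

/-- At k = 0 the absolute value |1 - k| puts the point outside the range of the convexity argument,
and strict positivity is needed for the lower bound on ψ. The value is (7 - 4·2^(2H) + 3^(2H))/2. -/
theorem fgnCorrelation_convex_zero (hH1 : 1 / 2 < H) (hH2 : H < 1) :
    0 < fgnCorrelation H 0 - 2 * fgnCorrelation H 1 + fgnCorrelation H 2 := by
  have h1 := fgnCorrelation_succ H 0
  have h2 := fgnCorrelation_succ H 1
  norm_num at h1 h2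
  rw [Real.zero_rpow (by linarith)] at h1
  rw [fgnCorrelation_zero (by linarith), h1, h2]
  have := seven_sub_four_mul_two_rpow_pos (p := 2 * H) (by linarith)
  norm_num
  linarith

theorem fgnCorrelation_convex (hH1 : 1 / 2 < H) (hH2 : H < 1) (k : ℕ) :
    0 ≤ fgnCorrelation H k - 2 * fgnCorrelation H (k + 1) + fgnCorrelation H (k + 2) := by
  cases k with
  | zero => exact (fgnCorrelation_convex_zero hH1 hH2).le
  | succ k =>
    have hk : (0 : ℝ) ≤ k := Nat.cast_nonneg k
    have hhalf : (0 : ℝ) ≤ 1 / 2 := by norm_num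
    have hx : (k : ℝ) + 1 ∈ Set.Ici (1 : ℝ) := Set.mem_Ici.2 (by linarith)
    have hy : (k : ℝ) + 1 + 1 + 1 ∈ Set.Ici (1 : ℝ) := Set.mem_Ici.2 (by linarith)
    have h := (convexOn_second_difference_rpow (p := 2 * H) (by linarith) (by linarith)).2
      hx hy hhalf hhalf (by norm_num)
    rw [show (1 / 2 : ℝ) • ((k : ℝ) + 1) + (1 / 2 : ℝ) • ((k : ℝ) + 1 + 1 + 1) = k + 1 + 1 by
      simp only [smul_eq_mul]; ring] at h
    rw [fgnCorrelation_succ', show k + 1 + 1 = (k + 1) + 1 by rfl, fgnCorrelation_succ',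
      show k + 1 + 2 = (k + 1 + 1) + 1 by rfl, fgnCorrelation_succ']
    push_cast
    rw [show (k : ℝ) + 2 + 1 = k + 1 + 1 + 1 by ring]
    simp only [smul_eq_mul] at h
    linarith

theorem tendsto_fgnCorrelation (hH1 : 1 / 2 < H) (hH2 : H < 1) :
    Tendsto (fgnCorrelation H) atTop (𝓝 0) := by
  rw [← tendsto_add_atTop_iff_nat 2]
  have hb : ∀ k : ℕ, 0 ≤ fgnCorrelation H (k + 2) ∧ fgnCorrelation H (k + 2) ≤
      1 / 2 * (2 * H * ((2 * H - 1) * 2) * ((k + 1 : ℕ) : ℝ) ^ (2 * H - 2)) := by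
    intro k
    have hk : (0 : ℝ) ≤ k := Nat.cast_nonneg k
    have h := second_difference_rpow_bounds (p := 2 * H) (by linarith) (by linarith)
      (x := (k : ℝ) + 1 + 1) (by linarith)
    rw [show k + 2 = (k + 1) + 1 by rfl, fgnCorrelation_succ']
    push_cast
    rw [show (k : ℝ) + 1 + 1 - 1 = k + 1 by ring] at h
    constructor <;> linarith [h.1, h.2]
  have hlim : Tendsto (fun k : ℕ => ((k + 1 : ℕ) : ℝ) ^ (2 * H - 2)) atTop (𝓝 0) := by
    have h := (tendsto_rpow_neg_atTop (y := 2 - 2 * H) (by linarith)).comp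
      (tendsto_natCast_atTop_atTop.comp (tendsto_add_atTop_nat 1))
    refine h.congr fun k => ?_
    simp [neg_sub]
  have hlim' := (hlim.const_mul (2 * H * ((2 * H - 1) * 2))).const_mul (1 / 2)
  rw [mul_zero, mul_zero] at hlim'
  exact squeeze_zero (fun k => (hb k).1) (fun k => (hb k).2) hlim'

theorem sum_fgnCorrelation_succ (hH : 0 < H) (N : ℕ) :
    ∑ k ∈ Finset.range N, fgnCorrelation H (k + 1) =
      1 / 2 * (((N : ℝ) + 1) ^ (2 * H) - (N : ℝ) ^ (2 * H) - 1) := by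
  induction N with
  | zero => simp [Real.zero_rpow (show 2 * H ≠ 0 by positivity)]
  | succ N ih =>
    rw [Finset.sum_range_succ, ih, fgnCorrelation_succ]
    push_cast
    rw [show (N : ℝ) + 1 + 1 = N + 2 by ring]
    ring

/-- The telescoped sums are at least (N^(2H-1) - 1)/2, and 2H - 1 > 0. -/
theorem not_summable_fgnCorrelation (hH1 : 1 / 2 < H) : ¬ Summable (fgnCorrelation H) := by
  intro hs
  have h1 := ((summable_nat_add_iff 1).2 hs).hasSum.tendsto_sum_nat
  have h2 : Tendsto (fun N : ℕ => 1 / 2 * ((N : ℝ) ^ (2 * H - 1) - 1)) atTop atTop := by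
    have h := (tendsto_rpow_atTop (y := 2 * H - 1) (by linarith)).comp
      (tendsto_natCast_atTop_atTop (R := ℝ))
    exact (tendsto_atTop_add_const_right _ (-1) h).const_mul_atTop (by norm_num)
  refine not_tendsto_nhds_of_tendsto_atTop (tendsto_atTop_mono' _ ?_ h2) _ h1
  filter_upwards [eventually_gt_atTop 0] with N hN
  have hN0 : (0 : ℝ) < N := by exact_mod_cast hN
  rw [sum_fgnCorrelation_succ (by linarith)]
  have e1 : ∀ y : ℝ, 0 < y → y ^ (2 * H) = y * y ^ (2 * H - 1) := fun y hy => by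
    rw [Real.rpow_sub_one hy.ne']
    field_simp
  have hmono : (N : ℝ) ^ (2 * H - 1) ≤ ((N : ℝ) + 1) ^ (2 * H - 1) :=
    Real.rpow_le_rpow hN0.le (by linarith) (by linarith)
  rw [e1 N hN0, e1 (N + 1) (by linarith)]
  nlinarith

end FractionalNoise

theorem mainTheorem1 {Ω : Type*} [MeasurableSpace Ω] (P : Measure Ω) [IsProbabilityMeasure P]
    (a b : ℕ → Ω → ℝ) :
    (∀ ρ : ℕ → ℝ,
      IsStandardStationaryGaussian P ρ a →
      IsStandardStationaryGaussian P ρ b →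
      IndepFun (fun ω k => a k ω) (fun ω k => b k ω) P →
      SpectralHypotheses ρ →
        (∀ n : ℕ, 1 ≤ n →
          AEMeasurable (numZeros a b n) P ∧ ∫⁻ ω, numZeros a b n ω ∂P < ∞) ∧
        (fun n : ℕ => (∫⁻ ω, numZeros a b n ω ∂P).toReal)
          ~[atTop] (fun n : ℕ => 2 * (n : ℝ) / Real.sqrt 3)) ∧
    (∀ H : ℝ, 1 / 2 < H → H < 1 →
      SpectralHypotheses (fgnCorrelation H) ∧ ¬ Summable (fgnCorrelation H)) :=
  ⟨fun _ ha hb hab hS => expected_numZeros ha hb hab hS, fun _ hH1 hH2 =>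
    ⟨spectralHypotheses_of_convex (fgnCorrelation_convex hH1 hH2)
      (fgnCorrelation_convex_zero hH1 hH2) (tendsto_fgnCorrelation hH1 hH2),
      not_summable_fgnCorrelation hH1⟩⟩
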